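/- Let $N\ge 2$ be an integer, $B_1$ the open unit ball of $\mathbb{R}^N$, $V_N$ its volume, and $\omega_{N-1}$ the $(N-1)$-dimensional measure of the unit sphere of $\mathbb{R}^N$. Put $$\widetilde{\omega_N}:=N^N\Big(\frac{N}{N-1}\Big)^{N-1}\omega_{N-1},\qquad \mu_N(x):=\frac{1}{V_N\big(1+|x|^{\frac{N}{N-1}}\big)^N},\qquad d\mu_N:=\mu_N(x)\,dx,\qquad v_N:=\ln\mu_N .$$ With $\nabla u$ denoting the weak gradient, let $$W_{\mu_N}(\mathbb{R}^N):=\Big\{u\in L^1(\mathbb{R}^N,d\mu_N):\ |\nabla u|\in L^N(\mathbb{R}^N,dx),\ |\nabla u|^2|\nabla v_N|^{N-2}\in L^1(\mathbb{R}^N,dx)\Big\},$$ and for $u\in W_{\mu_N}(\mathbb{R}^N)$ let $$I(u):=\frac{1}{\widetilde{\omega_N}}\int_{\mathbb{R}^N}\Big(|\nabla v_N+\nabla u|^N-|\nabla v_N|^N-N|\nabla v_N|^{N-2}\nabla v_N\cdot\nabla u\Big)dx+\int_{\mathbb{R}^N}u\,d\mu_N-\ln\Big(\int_{\mathbb{R}^N}e^u\,d\mu_N\Big).$$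 Let $W^{1,N}_0(B_1)$ be the closure of $C_c^\infty(B_1)$ in $W^{1,N}(B_1)$, and for $u\in W^{1,N}_0(B_1)$ let $$J(u):=\frac{1}{\widetilde{\omega_N}}\int_{B_1}|\nabla u|^N\,dx-\ln\Big(\frac{1}{V_N}\int_{B_1}e^u\,dx\Big).$$ Infima are taken in $[-\infty,+\infty]$, and $\ln(+\infty)=+\infty$. Then $$\inf_{u\in W_{\mu_N}(\mathbb{R}^N)}I(u)=\inf_{u\in W^{1,N}_0(B_1)}J(u)+\sum_{k=1}^{N-1}\frac1k .$$ -/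

import Mathlib

open MeasureTheory Filter Topology
open scoped ENNReal ContDiff Gradient

noncomputable section

namespace Onofri

/-- `g` is a weak (distributional) gradient of `u` on the open set `Ω ⊆ ℝᴺ`. -/
def HasWeakGradient {N : ℕ} (Ω : Set (EuclideanSpace ℝ (Fin N)))
    (u : EuclideanSpace ℝ (Fin N) → ℝ)
    (g : EuclideanSpace ℝ (Fin N) → EuclideanSpace ℝ (Fin N)) : Prop :=
  LocallyIntegrableOn u Ω volume ∧ LocallyIntegrableOn g Ω volume ∧
    ∀ φ : EuclideanSpace ℝ (Fin N) → ℝ, ContDiff ℝ ∞ φ → HasCompactSupport φ → tsupport φ ⊆ Ω →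
      ∫ x in Ω, u x • ∇ φ x = - ∫ x in Ω, φ x • g x

open Classical in
/-- The weak gradient of `u` on `Ω`. It is determined almost everywhere on `Ω` when it exists;
the default value `0` is never used below, as existence is always required separately. -/
def weakGradient {N : ℕ} (Ω : Set (EuclideanSpace ℝ (Fin N)))
    (u : EuclideanSpace ℝ (Fin N) → ℝ) :
    EuclideanSpace ℝ (Fin N) → EuclideanSpace ℝ (Fin N) :=
  if h : ∃ g, HasWeakGradient Ω u g then h.choose else 0

/-- The Sobolev space `W^{1,p}(Ω)`; only the values of `u` on `Ω` matter. -/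
def sobolevW1 {N : ℕ} (p : ℝ≥0∞) (Ω : Set (EuclideanSpace ℝ (Fin N))) :
    Set (EuclideanSpace ℝ (Fin N) → ℝ) :=
  {u | MemLp u p (volume.restrict Ω) ∧ (∃ g, HasWeakGradient Ω u g) ∧
    MemLp (weakGradient Ω u) p (volume.restrict Ω)}

/-- The space `W₀^{1,p}(Ω)`: the closure of `C_c^∞(Ω)` in `W^{1,p}(Ω)`. -/
def sobolevW10 {N : ℕ} (p : ℝ≥0∞) (Ω : Set (EuclideanSpace ℝ (Fin N))) :
    Set (EuclideanSpace ℝ (Fin N) → ℝ) :=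
  {u | u ∈ sobolevW1 p Ω ∧ ∃ φ : ℕ → EuclideanSpace ℝ (Fin N) → ℝ,
    (∀ k, ContDiff ℝ ∞ (φ k) ∧ HasCompactSupport (φ k) ∧ tsupport (φ k) ⊆ Ω) ∧
    Tendsto (fun k => eLpNorm (φ k - u) p (volume.restrict Ω)) atTop (𝓝 0) ∧
    Tendsto (fun k => eLpNorm (∇ (φ k) - weakGradient Ω u) p (volume.restrict Ω)) atTop (𝓝 0)}

/-- The open unit ball `B₁` of `ℝᴺ`. -/
def unitBall (N : ℕ) : Set (EuclideanSpace ℝ (Fin N)) := Metric.ball 0 1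

/-- `V_N`, the volume of the unit ball of `ℝᴺ`. -/
def ballVolume (N : ℕ) : ℝ := (volume : Measure (EuclideanSpace ℝ (Fin N))).real (unitBall N)

/-- `ω_{N-1}`, the `(N-1)`-dimensional surface measure of the unit sphere of `ℝᴺ`. -/
def sphereArea (N : ℕ) : ℝ :=
  (volume : Measure (EuclideanSpace ℝ (Fin N))).toSphere.real Set.univ

/-- The constant `ω̃_N = N^N (N/(N-1))^{N-1} ω_{N-1}`. -/
def omegaTilde (N : ℕ) : ℝ :=
  (N : ℝ) ^ N * ((N : ℝ) / ((N : ℝ) - 1)) ^ (N - 1) * sphereArea N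

/-- The density `μ_N(x) = 1 / (V_N (1 + |x|^{N/(N-1)})^N)`. -/
def muDensity (N : ℕ) (x : EuclideanSpace ℝ (Fin N)) : ℝ :=
  1 / (ballVolume N * (1 + ‖x‖ ^ ((N : ℝ) / ((N : ℝ) - 1))) ^ N)

/-- The measure `dμ_N = μ_N(x) dx`. -/
def muMeasure (N : ℕ) : Measure (EuclideanSpace ℝ (Fin N)) :=
  volume.withDensity (fun x => ENNReal.ofReal (muDensity N x))

/-- `v_N = ln μ_N`. -/
def vN (N : ℕ) (x : EuclideanSpace ℝ (Fin N)) : ℝ := Real.log (muDensity N x)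

/-- `R_N(X, Y) = |X + Y|^N - |X|^N - N |X|^{N-2} X · Y`. -/
def remainder (N : ℕ) (X Y : EuclideanSpace ℝ (Fin N)) : ℝ :=
  ‖X + Y‖ ^ N - ‖X‖ ^ N - N * ‖X‖ ^ (N - 2) * inner ℝ X Y

/-- `H_N(u, μ_N) = R_N(∇v_N, ∇u)`. -/
def HN (N : ℕ) (u : EuclideanSpace ℝ (Fin N) → ℝ) (x : EuclideanSpace ℝ (Fin N)) : ℝ :=
  remainder N (∇ (vN N) x) (weakGradient Set.univ u x)

/-- The weighted Sobolev space `W_{μ_N}(ℝᴺ)`. -/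
def weightedSobolev (N : ℕ) : Set (EuclideanSpace ℝ (Fin N) → ℝ) :=
  {u | Integrable u (muMeasure N) ∧ (∃ g, HasWeakGradient Set.univ u g) ∧
    MemLp (weakGradient Set.univ u) N volume ∧
    Integrable (fun x => ‖weakGradient Set.univ u x‖ ^ 2 * ‖∇ (vN N) x‖ ^ (N - 2)) volume}

/-- The Euclidean Onofri functional
`I(u) = (1/ω̃_N) ∫ H_N(u, μ_N) dx + ∫ u dμ_N - ln ∫ e^u dμ_N`, where `ln ∞ = ∞`. -/
def functionalI (N : ℕ) (u : EuclideanSpace ℝ (Fin N) → ℝ) : EReal :=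
  (((1 / omegaTilde N) * (∫ x, HN N u x) + ∫ x, u x ∂(muMeasure N) : ℝ) : EReal)
    - ENNReal.log (∫⁻ x, ENNReal.ofReal (Real.exp (u x)) ∂(muMeasure N))

/-- The Carleson–Chang functional
`J(u) = (1/ω̃_N) ∫_{B₁} |∇u|^N dx - ln ((1/V_N) ∫_{B₁} e^u dx)`, where `ln ∞ = ∞`. -/
def functionalJ (N : ℕ) (u : EuclideanSpace ℝ (Fin N) → ℝ) : EReal :=
  (((1 / omegaTilde N) * (∫ x in unitBall N, ‖weakGradient (unitBall N) u x‖ ^ N) : ℝ) : EReal)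
    - ENNReal.log (ENNReal.ofReal (1 / ballVolume N) *
        ∫⁻ x in unitBall N, ENNReal.ofReal (Real.exp (u x)))

end Onofri

end

namespace Onofri

noncomputable section

variable {N : ℕ}

/-! The density satisfies $-\Delta_N v_N=(\widetilde{\omega_N}/N)\,\mu_N$. Let $z$ be Lipschitz and
vanish outside $B_S$, and put $w=z+(v_N-v_N(S))_+$, which also vanishes there. On $B_S$ one has
$\nabla w=\nabla v_N+\nabla z$. Expanding $|\nabla w|^N$ yields the remainder, $|\nabla v_N|^N$ and
a first-order term, which the equation turns into $\widetilde{\omega_N}\int z\,d\mu_N$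
(`integral_norm_gradient_addCap`). Also $e^z\mu_N=e^{v_N(S)}e^w$ on $B_S$. The $N$-energy is
invariant under dilations, so after rescaling $B_S$ to $B_1$ the two functionals differ only by the
explicit constant `ballDefect N S`, up to the mass of $e^z\mu_N$ outside $B_S$. With $T=S^{N/(N-1)}$
and $\sigma=T/(1+T)$, this constant is $(N-1)\ln\sigma-\sum_{k<N}\sigma^k/k$, which tends to minus
the harmonic sum as $S\to\infty$ (`tendsto_ballDefect`).

An extended real is determined by the real numbers below it, so it suffices that $m$ bounds $I$ from
below exactly when $m$ minus the harmonic sum bounds $J$ from below. Both bounds are put in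
exponential form, which survives limits by Fatou's lemma (`lintegral_exp_le_of_tendsto`).

From $I$ to $J$ (`OnofriBound.carlesonChangBound`): a smooth $\varphi$ on $B_1$ is dilated to $B_S$,
the cap is subtracted, the mass outside $B_S$ is dropped and $S\to\infty$; density of $C_c^\infty$
does the rest. From $J$ to $I$ (`CarlesonChangBound.onofriBound`): the same comparison handles
Lipschitz $z$ of compact support. A general $u$ is then approximated by $\eta_k T_k(u)$, with $T_k$
a smooth bounded truncation and $\eta_k$ a cutoff of tiny energy, which exists because infinity has
zero $N$-capacity (`exists_cutoff`). The remainder integrals converge because the remainder is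
dominated by the two quantities whose integrability defines $W_{\mu_N}$ (`abs_remainder_le`). -/

/-- Dominated convergence with a convergent sequence of majorants. -/
theorem tendsto_integral_of_dominated_tendsto {α : Type*} [MeasurableSpace α] {μ : Measure α}
    {F G : ℕ → α → ℝ} {f g : α → ℝ} (hFm : ∀ n, AEStronglyMeasurable (F n) μ)
    (hG : ∀ n, Integrable (G n) μ) (hg : Integrable g μ)
    (hFG : ∀ n, ∀ᵐ x ∂μ, |F n x| ≤ G n x)
    (hF : ∀ᵐ x ∂μ, Tendsto (fun n => F n x) atTop (𝓝 (f x)))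
    (hGg : ∀ᵐ x ∂μ, Tendsto (fun n => G n x) atTop (𝓝 (g x)))
    (hint : Tendsto (fun n => ∫ x, G n x ∂μ) atTop (𝓝 (∫ x, g x ∂μ))) :
    Tendsto (fun n => ∫ x, F n x ∂μ) atTop (𝓝 (∫ x, f x ∂μ)) := by
  have hFG' : ∀ᵐ x ∂μ, ∀ n, |F n x| ≤ G n x := ae_all_iff.2 hFG
  have hFi : ∀ n, Integrable (F n) μ := fun n => (hG n).mono' (hFm n) (hFG n)
  have hfg : ∀ᵐ x ∂μ, |f x| ≤ g x := by
    filter_upwards [hFG', hF, hGg] with x h1 h2 h3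
    exact le_of_tendsto_of_tendsto' h2.abs h3 h1
  -- The negative part of `G n - g` is at most `g`, because `G n ≥ 0`. Convergence of the integrals
  -- then forces the positive part to vanish in $L^1$ as well.
  have hneg : Tendsto (fun n => ∫ x, max (g x - G n x) 0 ∂μ) atTop (𝓝 0) := by
    have : Tendsto (fun n => ∫ x, max (g x - G n x) 0 ∂μ) atTop (𝓝 (∫ _, (0 : ℝ) ∂μ)) := by
      refine tendsto_integral_of_dominated_convergence g
        (fun n => ((hg.sub (hG n)).pos_part).aestronglyMeasurable) hg ?_ ?_
      · intro n
        filter_upwards [hFG', hfg] with x h1 h2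
        have := (abs_nonneg _).trans (h1 n)
        have := (abs_nonneg _).trans h2
        rw [Real.norm_eq_abs, abs_of_nonneg (le_max_right _ _)]
        exact max_le (by linarith) (by linarith)
      · filter_upwards [hGg] with x h
        have h1 : Tendsto (fun n => max (g x - G n x) 0) atTop (𝓝 (max (g x - g x) 0)) :=
          (tendsto_const_nhds.sub h).max tendsto_const_nhds
        simpa using h1
    simpa using this
  have hpos : Tendsto (fun n => ∫ x, max (G n x - g x) 0 ∂μ) atTop (𝓝 0) := by
    have h1 : ∀ n, ∫ x, max (G n x - g x) 0 ∂μ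
        = (∫ x, G n x ∂μ - ∫ x, g x ∂μ) + ∫ x, max (g x - G n x) 0 ∂μ := by
      intro n
      have h2 : Integrable (fun x => G n x - g x) μ := (hG n).sub hg
      have h3 : Integrable (fun x => max (g x - G n x) 0) μ := (hg.sub (hG n)).pos_part
      rw [← integral_sub (hG n) hg, ← integral_add h2 h3]
      congr 1
      ext x
      rcases le_total (G n x) (g x) with h | h
      · rw [max_eq_right (by linarith), max_eq_left (by linarith)]; ring
      · rw [max_eq_left (by linarith), max_eq_right (by linarith)]; ring
    simp_rw [h1]
    simpa using (hint.sub_const (∫ x, g x ∂μ)).add hneg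
  -- Clipping `F n` to `[-g, g]` brings it under classical dominated convergence; the clipping error
  -- is at most `(G n - g)₊`.
  have hclipm : ∀ n, AEStronglyMeasurable (fun x => max (min (F n x) (g x)) (-g x)) μ := fun n =>
    ((hFm n).inf hg.aestronglyMeasurable).sup hg.aestronglyMeasurable.neg
  have hclipb : ∀ n, ∀ᵐ x ∂μ, ‖max (min (F n x) (g x)) (-g x)‖ ≤ g x := by
    intro n
    filter_upwards [hfg] with x h
    have := (abs_nonneg _).trans h
    rw [Real.norm_eq_abs, abs_le]
    exact ⟨le_max_right _ _, max_le (min_le_right _ _) (by linarith)⟩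
  have hclip : Tendsto (fun n => ∫ x, max (min (F n x) (g x)) (-g x) ∂μ) atTop
      (𝓝 (∫ x, f x ∂μ)) := by
    refine tendsto_integral_of_dominated_convergence g hclipm hg hclipb ?_
    filter_upwards [hF, hfg] with x h1 h2
    have h3 : Tendsto (fun n => max (min (F n x) (g x)) (-g x)) atTop
        (𝓝 (max (min (f x) (g x)) (-g x))) :=
      (h1.min tendsto_const_nhds).max tendsto_const_nhds
    rwa [min_eq_left (abs_le.1 h2).2, max_eq_left (abs_le.1 h2).1] at h3
  have hdiff : Tendsto (fun n => ∫ x, F n x ∂μ - ∫ x, max (min (F n x) (g x)) (-g x) ∂μ) atTop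
      (𝓝 0) := by
    refine squeeze_zero_norm (fun n => ?_) hpos
    have hci : Integrable (fun x => max (min (F n x) (g x)) (-g x)) μ :=
      hg.mono' (hclipm n) (hclipb n)
    rw [← integral_sub (hFi n) hci]
    refine norm_integral_le_of_norm_le (((hG n).sub hg).pos_part) ?_
    filter_upwards [hFG', hfg] with x h1 h2
    have h1 := abs_le.1 (h1 n)
    have h3 := (abs_nonneg _).trans h2
    rw [Real.norm_eq_abs]
    rcases le_total (F n x) (g x) with h4 | h4
    · rw [min_eq_left h4]
      rcases le_total (F n x) (-g x) with h5 | h5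
      · rw [max_eq_right h5, abs_of_nonpos (by linarith)]
        exact le_max_of_le_left (by linarith)
      · rw [max_eq_left h5]; simp
    · rw [min_eq_right h4, max_eq_left (by linarith), abs_of_nonneg (by linarith)]
      exact le_max_of_le_left (by linarith)
  simpa using hdiff.add hclip

/-! ### Pointwise size of the remainder -/

/-- The second-order Bernoulli remainder of `t ↦ t ^ n`. -/
theorem abs_pow_sub_tangent_le (n : ℕ) {p x : ℝ} (hp : 0 ≤ p) (hx : 0 ≤ x) :
    |p ^ (n + 2) - x ^ (n + 2) - (n + 2) * x ^ (n + 1) * (p - x)|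
      ≤ (n + 2) ^ 2 * (p - x) ^ 2 * (p + x) ^ n := by
  induction n with
  | zero =>
    have : p ^ 2 - x ^ 2 - (((0 : ℕ) : ℝ) + 2) * x ^ (0 + 1) * (p - x) = (p - x) ^ 2 := by
      push_cast; ring
    rw [zero_add, this, abs_of_nonneg (sq_nonneg _)]
    push_cast
    nlinarith [sq_nonneg (p - x)]
  | succ n ih =>
    have e : p ^ (n + 1 + 2) - x ^ (n + 1 + 2) - (((n + 1 : ℕ) : ℝ) + 2) * x ^ (n + 1 + 1) * (p - x)
        = p * (p ^ (n + 2) - x ^ (n + 2) - (n + 2) * x ^ (n + 1) * (p - x))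
          + (n + 2) * x ^ (n + 1) * (p - x) ^ 2 := by
      push_cast; ring
    rw [e]
    refine (abs_add_le _ _).trans ?_
    rw [abs_mul, abs_of_nonneg hp, abs_of_nonneg (by positivity : 0 ≤ (n + 2) * x ^ (n + 1) * (p - x) ^ 2)]
    have h1 : x ^ (n + 1) ≤ (p + x) ^ (n + 1) := pow_le_pow_left₀ hx (by linarith) _
    have h2 : p * (p + x) ^ n ≤ (p + x) ^ (n + 1) := by
      rw [pow_succ']; exact mul_le_mul_of_nonneg_right (by linarith) (by positivity)
    calc p * |p ^ (n + 2) - x ^ (n + 2) - (n + 2) * x ^ (n + 1) * (p - x)|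
          + (n + 2) * x ^ (n + 1) * (p - x) ^ 2
        ≤ p * ((n + 2) ^ 2 * (p - x) ^ 2 * (p + x) ^ n) + (n + 2) * x ^ (n + 1) * (p - x) ^ 2 := by
          gcongr
      _ = (n + 2) ^ 2 * (p - x) ^ 2 * (p * (p + x) ^ n) + (n + 2) * x ^ (n + 1) * (p - x) ^ 2 := by
          ring
      _ ≤ (n + 2) ^ 2 * (p - x) ^ 2 * (p + x) ^ (n + 1)
          + (n + 2) * (p + x) ^ (n + 1) * (p - x) ^ 2 := by gcongr
      _ = ((n + 2) ^ 2 + (n + 2)) * (p - x) ^ 2 * (p + x) ^ (n + 1) := by ring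
      _ ≤ (((n + 1 : ℕ) : ℝ) + 2) ^ 2 * (p - x) ^ 2 * (p + x) ^ (n + 1) := by
          gcongr; push_cast; nlinarith [(n.cast_nonneg : (0 : ℝ) ≤ n)]

theorem remainder_zero_right {N : ℕ} (X : EuclideanSpace ℝ (Fin N)) : remainder N X 0 = 0 := by
  simp [remainder]

theorem continuous_remainder (N : ℕ) :
    Continuous fun p : EuclideanSpace ℝ (Fin N) × EuclideanSpace ℝ (Fin N) =>
      remainder N p.1 p.2 := by
  unfold remainder; fun_prop

/-- By polarization the remainder depends only on $x=|X|$, $y=|Y|$, $p=|X+Y|$: it is the scalar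
Taylor remainder of $t^N$ at $x$ plus $\frac N2x^{N-2}(y^2-(p-x)^2)$, and $|p-x|\le y$. The two
terms of the bound are those made integrable by the definition of $W_{\mu_N}$. -/
theorem abs_remainder_le {N : ℕ} (hN : 2 ≤ N) : ∃ C : ℝ, 0 ≤ C ∧
    ∀ X Y : EuclideanSpace ℝ (Fin N),
      |remainder N X Y| ≤ C * (‖X‖ ^ (N - 2) * ‖Y‖ ^ 2 + ‖Y‖ ^ N) := by
  obtain ⟨n, rfl⟩ : ∃ n, N = n + 2 := ⟨N - 2, by omega⟩
  refine ⟨((n + 2) ^ 2 + (n + 2)) * 3 ^ n, by positivity, fun X Y => ?_⟩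
  rw [Nat.add_sub_cancel]
  set x := ‖X‖
  set y := ‖Y‖
  set p := ‖X + Y‖ with hpdef
  have hx : 0 ≤ x := norm_nonneg _
  have hy : 0 ≤ y := norm_nonneg _
  have hp : 0 ≤ p := norm_nonneg _
  have hpx : (p - x) ^ 2 ≤ y ^ 2 := by
    rw [sq_le_sq, abs_of_nonneg hy]
    simpa using abs_norm_sub_norm_le (X + Y) X
  have hpy : p ≤ x + y := norm_add_le _ _
  have hin : inner ℝ X Y = (p ^ 2 - x ^ 2 - y ^ 2) / 2 := by
    have := norm_add_sq_real X Y
    rw [hpdef]; linarith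
  have e : remainder (n + 2) X Y = (p ^ (n + 2) - x ^ (n + 2) - (n + 2) * x ^ (n + 1) * (p - x))
      + (n + 2) / 2 * x ^ n * (y ^ 2 - (p - x) ^ 2) := by
    simp only [remainder, hin, Nat.add_sub_cancel]
    push_cast; ring
  have hM : (p + x) ^ n ≤ 3 ^ n * (x ^ n + y ^ n) := by
    rcases le_total x y with h | h
    · calc (p + x) ^ n ≤ (3 * y) ^ n := pow_le_pow_left₀ (by positivity) (by linarith) _
        _ = 3 ^ n * y ^ n := mul_pow _ _ _
        _ ≤ _ := by gcongr; linarith [pow_nonneg hx n]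
    · calc (p + x) ^ n ≤ (3 * x) ^ n := pow_le_pow_left₀ (by positivity) (by linarith) _
        _ = 3 ^ n * x ^ n := mul_pow _ _ _
        _ ≤ _ := by gcongr; linarith [pow_nonneg hy n]
  rw [e]
  calc _ ≤ |p ^ (n + 2) - x ^ (n + 2) - (n + 2) * x ^ (n + 1) * (p - x)|
        + |(n + 2) / 2 * x ^ n * (y ^ 2 - (p - x) ^ 2)| := abs_add_le _ _
    _ ≤ (n + 2) ^ 2 * (p - x) ^ 2 * (p + x) ^ n + (n + 2) / 2 * x ^ n * y ^ 2 := by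
        refine add_le_add (abs_pow_sub_tangent_le n hp hx) ?_
        rw [abs_mul, abs_of_nonneg (by positivity : (0 : ℝ) ≤ (n + 2) / 2 * x ^ n),
          abs_of_nonneg (by linarith)]
        gcongr
        linarith [sq_nonneg (p - x)]
    _ ≤ (n + 2) ^ 2 * y ^ 2 * (3 ^ n * (x ^ n + y ^ n)) + (n + 2) * 3 ^ n * (x ^ n * y ^ 2 + y ^ (n + 2)) := by
        gcongr ?_ + ?_
        · gcongr
        · have h3 : (1 : ℝ) ≤ 3 ^ n := one_le_pow₀ (by norm_num)
          have h4 : 0 ≤ x ^ n * y ^ 2 := by positivity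
          have h5 : 0 ≤ y ^ (n + 2) := by positivity
          calc (n + 2 : ℝ) / 2 * x ^ n * y ^ 2 = (n + 2) / 2 * 1 * (x ^ n * y ^ 2) := by ring
            _ ≤ (n + 2) * 3 ^ n * (x ^ n * y ^ 2 + y ^ (n + 2)) := by
              gcongr
              · linarith
              · linarith
    _ = _ := by ring

/-! ### Gradients -/

theorem norm_gradient_eq (f : EuclideanSpace ℝ (Fin N) → ℝ) (x : EuclideanSpace ℝ (Fin N)) :
    ‖∇ f x‖ = ‖fderiv ℝ f x‖ := by
  simp [gradient]

theorem measurable_gradient (f : EuclideanSpace ℝ (Fin N) → ℝ) : Measurable (∇ f) :=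
  (InnerProductSpace.toDual ℝ _).symm.continuous.measurable.comp (measurable_fderiv ℝ f)

theorem continuous_gradient {f : EuclideanSpace ℝ (Fin N) → ℝ} (hf : ContDiff ℝ 1 f) :
    Continuous (∇ f) :=
  (InnerProductSpace.toDual ℝ _).symm.continuous.comp (hf.continuous_fderiv one_ne_zero)

theorem gradient_of_eventuallyEq_const {f : EuclideanSpace ℝ (Fin N) → ℝ}
    {x : EuclideanSpace ℝ (Fin N)} {c : ℝ} (h : f =ᶠ[𝓝 x] fun _ => c) : ∇ f x = 0 := by
  rw [h.gradient_eq, gradient_fun_const]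

theorem norm_gradient_le_of_lipschitz {f : EuclideanSpace ℝ (Fin N) → ℝ} {C : NNReal}
    (hf : LipschitzWith C f) (x : EuclideanSpace ℝ (Fin N)) : ‖∇ f x‖ ≤ C := by
  rw [norm_gradient_eq]; exact norm_fderiv_le_of_lipschitz ℝ hf

theorem gradient_fun_add {f g : EuclideanSpace ℝ (Fin N) → ℝ} {x : EuclideanSpace ℝ (Fin N)}
    (hf : DifferentiableAt ℝ f x) (hg : DifferentiableAt ℝ g x) :
    ∇ (fun y => f y + g y) x = ∇ f x + ∇ g x := by
  rw [gradient, fderiv_fun_add hf hg, map_add, gradient, gradient]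

theorem eq_zero_nhds_of_norm_gt {f : EuclideanSpace ℝ (Fin N) → ℝ} {S : ℝ}
    (hf : ∀ x, S < ‖x‖ → f x = 0) {x : EuclideanSpace ℝ (Fin N)} (hx : S < ‖x‖) :
    f =ᶠ[𝓝 x] fun _ => 0 := by
  filter_upwards [(isOpen_lt continuous_const continuous_norm).mem_nhds hx] with y hy
  exact hf y hy

theorem hasCompactSupport_of_norm_gt {F : Type*} [Zero F] {f : EuclideanSpace ℝ (Fin N) → F}
    {S : ℝ} (hf : ∀ x, S < ‖x‖ → f x = 0) : HasCompactSupport f :=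
  HasCompactSupport.intro (isCompact_closedBall 0 S) fun x hx =>
    hf x (by simpa using hx)

theorem integrable_of_bounded_of_norm_gt {F : Type*} [NormedAddCommGroup F]
    {f : EuclideanSpace ℝ (Fin N) → F} {S C : ℝ}
    (hm : AEStronglyMeasurable f volume) (hC : ∀ x, ‖f x‖ ≤ C) (hf : ∀ x, S < ‖x‖ → f x = 0) :
    Integrable f volume := by
  have h : Integrable ((Metric.closedBall (0 : EuclideanSpace ℝ (Fin N)) S).indicator
      fun _ => C) volume :=
    (integrable_indicator_iff Metric.isClosed_closedBall.measurableSet).2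
      (integrableOn_const (isCompact_closedBall _ _).measure_lt_top.ne)
  refine h.mono' hm (Eventually.of_forall fun x => ?_)
  by_cases hx : x ∈ Metric.closedBall (0 : EuclideanSpace ℝ (Fin N)) S
  · rw [Set.indicator_of_mem hx]; exact hC x
  · rw [Set.indicator_of_notMem hx, hf x (by simpa using hx), norm_zero]

theorem ae_norm_ne (hN : N ≠ 0) (S : ℝ) : ∀ᵐ x : EuclideanSpace ℝ (Fin N), ‖x‖ ≠ S := by
  have : Nonempty (Fin N) := ⟨⟨0, Nat.pos_of_ne_zero hN⟩⟩
  have h := Measure.addHaar_sphere (volume : Measure (EuclideanSpace ℝ (Fin N))) 0 S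
  filter_upwards [measure_eq_zero_iff_ae_notMem.1 h] with x hx
  simpa using hx

/-! ### Weak gradients -/

theorem setIntegral_eq_of_tsupport_subset {F : Type*} [NormedAddCommGroup F] [NormedSpace ℝ F]
    {Ω : Set (EuclideanSpace ℝ (Fin N))} {f : EuclideanSpace ℝ (Fin N) → F}
    {φ : EuclideanSpace ℝ (Fin N) → ℝ} (hφ : tsupport φ ⊆ Ω)
    (hf : ∀ x, x ∉ tsupport φ → f x = 0) : ∫ x in Ω, f x = ∫ x, f x :=
  setIntegral_eq_integral_of_forall_compl_eq_zero fun x hx => hf x fun h => hx (hφ h)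

theorem gradient_eq_zero_of_notMem_tsupport {φ : EuclideanSpace ℝ (Fin N) → ℝ}
    {x : EuclideanSpace ℝ (Fin N)} (hx : x ∉ tsupport φ) : ∇ φ x = 0 :=
  gradient_of_eventuallyEq_const (notMem_tsupport_iff_eventuallyEq.1 hx)

theorem HasWeakGradient.mono {Ω : Set (EuclideanSpace ℝ (Fin N))}
    {u : EuclideanSpace ℝ (Fin N) → ℝ} {g : EuclideanSpace ℝ (Fin N) → EuclideanSpace ℝ (Fin N)}
    (h : HasWeakGradient Set.univ u g) : HasWeakGradient Ω u g := by
  refine ⟨h.1.mono_set (Set.subset_univ _), h.2.1.mono_set (Set.subset_univ _),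
    fun φ hφ hc hs => ?_⟩
  rw [setIntegral_eq_of_tsupport_subset hs, setIntegral_eq_of_tsupport_subset hs]
  · simpa using h.2.2 φ hφ hc (Set.subset_univ _)
  · intro x hx; rw [image_eq_zero_of_notMem_tsupport hx, zero_smul]
  · intro x hx; rw [gradient_eq_zero_of_notMem_tsupport hx, smul_zero]

/-- Fundamental lemma of the calculus of variations applied to the difference of the two gradients.
It makes the choice in `weakGradient` harmless. -/
theorem HasWeakGradient.ae_eq {Ω : Set (EuclideanSpace ℝ (Fin N))} (hΩ : IsOpen Ω)
    {u : EuclideanSpace ℝ (Fin N) → ℝ} {g g' : EuclideanSpace ℝ (Fin N) → EuclideanSpace ℝ (Fin N)}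
    (h : HasWeakGradient Ω u g) (h' : HasWeakGradient Ω u g') :
    g =ᵐ[volume.restrict Ω] g' := by
  have key : ∀ᵐ x : EuclideanSpace ℝ (Fin N), x ∈ Ω → (g - g') x = 0 := by
    refine hΩ.ae_eq_zero_of_integral_contDiff_smul_eq_zero (h.2.1.sub h'.2.1) fun φ hφ hc hs => ?_
    have e : ∀ f : EuclideanSpace ℝ (Fin N) → EuclideanSpace ℝ (Fin N),
        LocallyIntegrableOn f Ω volume → IntegrableOn (fun x => φ x • f x) Ω volume := by
      intro f hf
      have h1 : IntegrableOn f (tsupport φ) volume := hf.integrableOn_compact_subset hs hc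
      have h2 : IntegrableOn (fun x => φ x • f x) (tsupport φ) volume :=
        h1.continuousOn_smul hφ.continuous.continuousOn hc
      have h3 : Integrable (fun x => φ x • f x) volume :=
        (integrableOn_iff_integrable_of_support_subset fun x hx => by
          by_contra hx'
          exact hx (by simp [image_eq_zero_of_notMem_tsupport hx'])).1 h2
      exact h3.integrableOn
    rw [← setIntegral_eq_of_tsupport_subset hs]
    · simp only [Pi.sub_apply, smul_sub]
      rw [integral_sub (e g h.2.1) (e g' h'.2.1), sub_eq_zero, ← neg_inj, ← h.2.2 φ hφ hc hs,
        ← h'.2.2 φ hφ hc hs]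
    · intro x hx; rw [image_eq_zero_of_notMem_tsupport hx, zero_smul]
  rw [Filter.EventuallyEq, ae_restrict_iff' hΩ.measurableSet]
  filter_upwards [key] with x hx h
  exact sub_eq_zero.1 (hx h)

theorem hasWeakGradient_weakGradient {Ω : Set (EuclideanSpace ℝ (Fin N))}
    {u : EuclideanSpace ℝ (Fin N) → ℝ} (h : ∃ g, HasWeakGradient Ω u g) :
    HasWeakGradient Ω u (weakGradient Ω u) := by
  rw [weakGradient, dif_pos h]; exact h.choose_spec

theorem HasWeakGradient.weakGradient_ae_eq {Ω : Set (EuclideanSpace ℝ (Fin N))} (hΩ : IsOpen Ω)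
    {u : EuclideanSpace ℝ (Fin N) → ℝ} {g : EuclideanSpace ℝ (Fin N) → EuclideanSpace ℝ (Fin N)}
    (h : HasWeakGradient Ω u g) : weakGradient Ω u =ᵐ[volume.restrict Ω] g :=
  (hasWeakGradient_weakGradient ⟨g, h⟩).ae_eq hΩ h

/-- The gradient of a `C¹` function integrates by parts against Lipschitz functions of compact
support. -/
theorem integral_fderiv_mul_eq_neg {f z : EuclideanSpace ℝ (Fin N) → ℝ} (hf : ContDiff ℝ 1 f)
    {C : NNReal} (hz : LipschitzWith C z) (hzc : HasCompactSupport z)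
    (y : EuclideanSpace ℝ (Fin N)) :
    ∫ x, fderiv ℝ z x y * f x = - ∫ x, fderiv ℝ f x y * z x := by
  obtain ⟨r, hr, hzr⟩ : ∃ r : ℝ, 0 < r ∧ ∀ x, r ≤ ‖x‖ → z x = 0 := by
    obtain ⟨r, hr⟩ := hzc.isCompact.isBounded.subset_ball 0
    refine ⟨max r 1, by positivity, fun x hx => image_eq_zero_of_notMem_tsupport fun h => ?_⟩
    have := hr h
    rw [mem_ball_zero_iff] at this
    exact absurd (le_max_left r 1) (by linarith)
  -- Since `f` need not have compact support, it is multiplied by a bump equal to one beyond the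
  -- support of `z`. The extra unit of radius makes the product agree with `f` on a neighbourhood of
  -- that support.
  let χ : ContDiffBump (0 : EuclideanSpace ℝ (Fin N)) := ⟨r + 1, r + 2, by linarith, by linarith⟩
  have hχ1 : ∀ x, ‖x‖ < r + 1 → χ =ᶠ[𝓝 x] fun _ => 1 := fun x hx =>
    χ.eventuallyEq_one_of_mem_ball (by simpa using hx)
  have hFd : ContDiff ℝ 1 fun x => χ x * f x := χ.contDiff.mul hf
  have hFc : HasCompactSupport fun x => χ x * f x := χ.hasCompactSupport.mul_right
  obtain ⟨D, hD⟩ := hFd.lipschitzWith_of_hasCompactSupport hFc one_ne_zero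
  have key := LipschitzWith.integral_lineDeriv_mul_eq (μ := volume) hD hz hzc y
  have e1 : ∫ x, lineDeriv ℝ (fun x => χ x * f x) x y * z x = ∫ x, fderiv ℝ f x y * z x := by
    congr 1; ext x
    rcases lt_or_ge ‖x‖ (r + 1) with h | h
    · have : (fun x => χ x * f x) =ᶠ[𝓝 x] f := by
        filter_upwards [hχ1 x h] with y hy; rw [hy, one_mul]
      rw [(hFd.differentiable one_ne_zero x).lineDeriv_eq_fderiv, this.fderiv_eq]
    · rw [hzr x (by linarith), mul_zero, mul_zero]
  have e2 : ∫ x, lineDeriv ℝ z x (-y) * (χ x * f x) = - ∫ x, fderiv ℝ z x y * f x := by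
    rw [← integral_neg]
    apply integral_congr_ae
    filter_upwards [hz.ae_differentiableAt (μ := volume)] with x hx
    rw [hx.lineDeriv_eq_fderiv, map_neg]
    rcases lt_or_ge ‖x‖ (r + 1) with h | h
    · rw [(hχ1 x h).eq_of_nhds]; ring
    · have hz0 : fderiv ℝ z x = 0 := by
        have : z =ᶠ[𝓝 x] fun _ => 0 :=
          eq_zero_nhds_of_norm_gt (S := r) (fun y hy => hzr y hy.le) (by linarith)
        rw [this.fderiv_eq]; simp
      simp [hz0]
  rw [e1, e2] at key
  rw [key, neg_neg]

/-- A Lipschitz function of compact support is weakly differentiable, with its almost everywhere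
defined gradient. -/
theorem hasWeakGradient_of_lipschitz {z : EuclideanSpace ℝ (Fin N) → ℝ} {C : NNReal}
    (hz : LipschitzWith C z) (hzc : HasCompactSupport z) : HasWeakGradient Set.univ z (∇ z) := by
  have hloc : LocallyIntegrable (∇ z) volume := by
    refine (locallyIntegrable_const (C : ℝ)).mono (measurable_gradient z).aestronglyMeasurable
      (Eventually.of_forall fun x => ?_)
    rw [Real.norm_of_nonneg C.coe_nonneg]
    exact norm_gradient_le_of_lipschitz hz x
  refine ⟨hz.continuous.locallyIntegrable.locallyIntegrableOn _, hloc.locallyIntegrableOn _,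
    fun φ hφ hc _ => ?_⟩
  simp only [Measure.restrict_univ]
  have i1 : Integrable (fun x => z x • ∇ φ x) volume :=
    (hz.continuous.smul (continuous_gradient (hφ.of_le (by simp)))).integrable_of_hasCompactSupport
      hzc.smul_right
  have i2 : Integrable (fun x => φ x • ∇ z x) volume :=
    hloc.integrable_smul_left_of_hasCompactSupport hφ.continuous hc
  refine ext_inner_left ℝ fun y => ?_
  rw [inner_neg_right, ← integral_inner i1, ← integral_inner i2]
  have h := integral_fderiv_mul_eq_neg (hφ.of_le (by simp)) hz hzc y
  simp only [inner_smul_right, inner_gradient_right, conj_trivial]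
  have e1 : ∫ x, z x * fderiv ℝ φ x y = ∫ x, fderiv ℝ φ x y * z x := by
    congr 1; ext x; ring
  have e2 : ∫ x, φ x * fderiv ℝ z x y = ∫ x, fderiv ℝ z x y * φ x := by
    congr 1; ext x; ring
  rw [e1, e2, h, neg_neg]

/-! ### Mollification -/

/-- A bump function of radius `2 / (n + 1)` centred at the origin. -/
def mollifierBump (N n : ℕ) : ContDiffBump (0 : EuclideanSpace ℝ (Fin N)) :=
  ⟨1 / (n + 1), 2 / (n + 1), by positivity, by gcongr; norm_num⟩

/-- The mollification of `f` at scale `2 / (n + 1)`. -/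
def mollify {F : Type*} [NormedAddCommGroup F] [NormedSpace ℝ F]
    (f : EuclideanSpace ℝ (Fin N) → F) (n : ℕ) : EuclideanSpace ℝ (Fin N) → F :=
  MeasureTheory.convolution ((mollifierBump N n).normed volume) f
    (ContinuousLinearMap.lsmul ℝ ℝ) volume

theorem tendsto_mollifierBump_rOut (N : ℕ) :
    Tendsto (fun n => (mollifierBump N n).rOut) atTop (𝓝 0) := by
  have : Tendsto (fun n : ℕ => (2 : ℝ) * (1 / ((n : ℝ) + 1))) atTop (𝓝 (2 * 0)) :=
    tendsto_one_div_add_atTop_nhds_zero_nat.const_mul 2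
  simpa [mollifierBump, div_eq_mul_inv] using this

section
variable {F : Type*} [NormedAddCommGroup F] [NormedSpace ℝ F]

theorem mollify_apply (f : EuclideanSpace ℝ (Fin N) → F) (n : ℕ) (x : EuclideanSpace ℝ (Fin N)) :
    mollify f n x = ∫ t, (mollifierBump N n).normed volume (x - t) • f t := by
  rw [mollify, MeasureTheory.convolution_eq_swap]; rfl

theorem ae_tendsto_mollify {f : EuclideanSpace ℝ (Fin N) → F} [CompleteSpace F]
    (hf : LocallyIntegrable f volume) :
    ∀ᵐ x, Tendsto (fun n => mollify f n x) atTop (𝓝 (f x)) :=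
  -- The constant 2 is the fixed ratio of outer to inner radius, which lets Lebesgue differentiation
  -- apply.
  ContDiffBump.ae_convolution_tendsto_right_of_locallyIntegrable (K := 2)
    (tendsto_mollifierBump_rOut N)
    (Eventually.of_forall fun n => by simp only [mollifierBump]; ring_nf; rfl) hf

theorem contDiff_mollify [CompleteSpace F] {f : EuclideanSpace ℝ (Fin N) → F}
    (hf : LocallyIntegrable f volume) (n : ℕ) : ContDiff ℝ ∞ (mollify f n) :=
  HasCompactSupport.contDiff_convolution_left _ (mollifierBump N n).hasCompactSupport_normed
    (mollifierBump N n).contDiff_normed hf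

theorem integrable_mollifier_smul {f : EuclideanSpace ℝ (Fin N) → F}
    (hf : LocallyIntegrable f volume) (n : ℕ) (x : EuclideanSpace ℝ (Fin N)) :
    Integrable (fun t => (mollifierBump N n).normed volume (x - t) • f t) volume := by
  refine hf.integrable_smul_left_of_hasCompactSupport ?_ ?_
  · exact (mollifierBump N n).continuous_normed.comp (continuous_const.sub continuous_id)
  · exact (mollifierBump N n).hasCompactSupport_normed.comp_homeomorph (Homeomorph.subLeft x)

theorem integral_mollifier_sub (n : ℕ) (x : EuclideanSpace ℝ (Fin N)) :
    ∫ t, (mollifierBump N n).normed volume (x - t) = 1 := by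
  rw [integral_sub_left_eq_self (fun t => (mollifierBump N n).normed volume t) volume x,
    ContDiffBump.integral_normed]

theorem integrable_mollify {f : EuclideanSpace ℝ (Fin N) → F} (hf : Integrable f volume) (n : ℕ) :
    Integrable (mollify f n) volume :=
  (mollifierBump N n).integrable_normed.integrable_convolution _ hf

theorem integral_mollify [CompleteSpace F] {f : EuclideanSpace ℝ (Fin N) → F}
    (hf : Integrable f volume) (n : ℕ) : ∫ x, mollify f n x = ∫ x, f x := by
  refine (MeasureTheory.integral_convolution _ (mollifierBump N n).integrable_normed hf).trans ?_
  rw [ContDiffBump.integral_normed]; simp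

/-- Supporting line of a convex power, obtained by multiplying the previous case by `s`; the
discarded term is a nonnegative multiple of $(s-a)^2$. It serves Jensen's inequality below. -/
theorem tangent_le_pow (m : ℕ) {a s : ℝ} (ha : 0 ≤ a) (hs : 0 ≤ s) :
    a ^ (m + 1) + (m + 1) * a ^ m * (s - a) ≤ s ^ (m + 1) := by
  induction m with
  | zero => simp
  | succ m ih =>
    have h1 := mul_le_mul_of_nonneg_left ih hs
    have h2 : 0 ≤ (m + 1) * a ^ m * (s - a) ^ 2 := by positivity
    push_cast
    calc _ = s * (a ^ (m + 1) + (m + 1) * a ^ m * (s - a)) - (m + 1) * a ^ m * (s - a) ^ 2 := by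
          ring
      _ ≤ s * s ^ (m + 1) := by linarith
      _ = _ := by ring

/-- Jensen's inequality for mollification. -/
theorem norm_mollify_pow_le {f : EuclideanSpace ℝ (Fin N) → F} (hf : LocallyIntegrable f volume)
    {p : ℕ} (hp : 2 ≤ p) (hfm : LocallyIntegrable (fun x => ‖f x‖ ^ p) volume) (n : ℕ)
    (x : EuclideanSpace ℝ (Fin N)) :
    ‖mollify f n x‖ ^ p ≤ mollify (fun x => ‖f x‖ ^ p) n x := by
  obtain ⟨m, rfl⟩ : ∃ m, p = m + 2 := ⟨p - 2, by omega⟩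
  set ρ : EuclideanSpace ℝ (Fin N) → ℝ := fun t => (mollifierBump N n).normed volume (x - t)
  have hρ : ∀ t, 0 ≤ ρ t := fun t => ContDiffBump.nonneg_normed _ _
  set a := ∫ t, ρ t * ‖f t‖ with ha
  have ha0 : 0 ≤ a := integral_nonneg fun t => mul_nonneg (hρ t) (norm_nonneg _)
  have h1 : ‖mollify f n x‖ ≤ a := by
    rw [mollify_apply]
    refine (norm_integral_le_integral_norm _).trans (le_of_eq ?_)
    congr 1; ext t
    rw [norm_smul, Real.norm_of_nonneg (hρ t)]
  refine (pow_le_pow_left₀ (norm_nonneg _) h1 _).trans ?_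
  rw [mollify_apply]
  have i1 : Integrable (fun t => ρ t * ‖f t‖) volume := by
    simpa [norm_smul, abs_of_nonneg (hρ _), ρ] using (integrable_mollifier_smul hf n x).norm
  have i0 : Integrable ρ volume := by
    simpa using integrable_mollifier_smul (locallyIntegrable_const (1 : ℝ)) n x
  have i2 := integrable_mollifier_smul hfm n x
  -- The kernel has mass one and `a` is the mean of `‖f‖`, so the linear part of the tangent at `a`
  -- integrates to zero.
  have e : ∫ t, ρ t * (a ^ (m + 2) + (m + 2) * a ^ (m + 1) * (‖f t‖ - a)) = a ^ (m + 2) := by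
    have : ∀ t, ρ t * (a ^ (m + 2) + (m + 2) * a ^ (m + 1) * (‖f t‖ - a))
        = (a ^ (m + 2) - (m + 2) * a ^ (m + 2)) * ρ t + ((m + 2) * a ^ (m + 1)) * (ρ t * ‖f t‖) :=
      fun t => by ring
    simp_rw [this]
    rw [integral_add (i0.const_mul _) (i1.const_mul _), integral_const_mul, integral_const_mul,
      ← ha, integral_mollifier_sub]
    ring
  rw [← e]
  refine integral_mono ?_ i2 fun t => ?_
  · have : (fun t => ρ t * (a ^ (m + 2) + (m + 2) * a ^ (m + 1) * (‖f t‖ - a)))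
        = fun t => (a ^ (m + 2) - (m + 2) * a ^ (m + 2)) * ρ t
          + ((m + 2) * a ^ (m + 1)) * (ρ t * ‖f t‖) := by ext t; ring
    rw [this]
    exact (i0.const_mul _).add (i1.const_mul _)
  · refine mul_le_mul_of_nonneg_left ?_ (hρ t)
    have h := tangent_le_pow (m + 1) ha0 (norm_nonneg (f t))
    push_cast at h
    linarith

theorem mollify_eq_zero_of_norm_gt {f : EuclideanSpace ℝ (Fin N) → F} {S : ℝ}
    (hf : ∀ x, S < ‖x‖ → f x = 0) (n : ℕ) (x : EuclideanSpace ℝ (Fin N))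
    (hx : S + (mollifierBump N n).rOut < ‖x‖) : mollify f n x = 0 := by
  rw [mollify_apply]
  refine integral_eq_zero_of_ae (Eventually.of_forall fun t => ?_)
  rcases lt_or_ge S ‖t‖ with h | h
  · simp [hf t h]
  · have : (mollifierBump N n).normed volume (x - t) = 0 := by
      rw [← Function.notMem_support, ContDiffBump.support_normed_eq, mem_ball_zero_iff, not_lt]
      linarith [norm_sub_norm_le x t]
    simp [this]

end

/-- Mollification commutes with weak differentiation. -/
theorem HasWeakGradient.gradient_mollify {u : EuclideanSpace ℝ (Fin N) → ℝ}
    {g : EuclideanSpace ℝ (Fin N) → EuclideanSpace ℝ (Fin N)}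
    (h : HasWeakGradient Set.univ u g) (n : ℕ) (x : EuclideanSpace ℝ (Fin N)) :
    ∇ (mollify u n) x = mollify g n x := by
  have hu := locallyIntegrableOn_univ.1 h.1
  have hg := locallyIntegrableOn_univ.1 h.2.1
  set ρ := (mollifierBump N n).normed (volume : Measure (EuclideanSpace ℝ (Fin N))) with hρ
  have hρc : HasCompactSupport ρ := (mollifierBump N n).hasCompactSupport_normed
  have hρd : ContDiff ℝ ∞ ρ := (mollifierBump N n).contDiff_normed
  have hd := hρc.hasFDerivAt_convolution_left (ContinuousLinearMap.lsmul ℝ ℝ)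
    (hρd.of_le (by simp)) hu x
  have hφd : ContDiff ℝ ∞ fun t => ρ (x - t) := hρd.comp (contDiff_const.sub contDiff_id)
  have hφc : HasCompactSupport fun t => ρ (x - t) := hρc.comp_homeomorph (Homeomorph.subLeft x)
  -- The translated reflected kernel `t ↦ ρ (x - t)` is itself an admissible test function for the
  -- weak gradient.
  have hw := h.2.2 _ hφd hφc (Set.subset_univ _)
  have hφg : ∀ t y, fderiv ℝ (fun t => ρ (x - t)) t y = - fderiv ℝ ρ (x - t) y := by
    intro t y
    have h1 := ((hρd.differentiable (by simp)) (x - t)).hasFDerivAt.comp t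
      ((hasFDerivAt_const x t).sub (hasFDerivAt_id t))
    have h2 : fderiv ℝ (fun t => ρ (x - t)) t = _ := h1.fderiv
    rw [h2]; simp
  simp only [Measure.restrict_univ] at hw
  refine ext_inner_left ℝ fun y => ?_
  rw [inner_gradient_right, conj_trivial, mollify, hd.fderiv]
  have i2 := integrable_mollifier_smul hg n x
  have i1 : Integrable (fun t => u t • ∇ (fun t => ρ (x - t)) t) volume := by
    refine hu.integrable_smul_right_of_hasCompactSupport
      (continuous_gradient (hφd.of_le (by simp))) ?_
    exact (hφc.fderiv ℝ).comp_left (map_zero (InnerProductSpace.toDual ℝ _).symm)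
  have hw' := congrArg (inner ℝ y) hw
  rw [inner_neg_right, ← integral_inner i1, ← integral_inner i2] at hw'
  have i3 := ((hρc.fderiv ℝ).convolutionExists_left
    ((ContinuousLinearMap.lsmul ℝ ℝ).precompL (EuclideanSpace ℝ (Fin N)))
    (hρd.continuous_fderiv (by simp)) hu x).integrable_swap
  rw [mollify_apply, ← integral_inner i2, ← neg_inj, ← hw', MeasureTheory.convolution_eq_swap,
    ContinuousLinearMap.integral_apply i3, ← integral_neg]
  congr 1; ext t
  simp [inner_smul_right, inner_gradient_right, hφg, mul_comm]

/-! ### The logarithm of the density -/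

/-- The exponent conjugate to `N`. -/
def conjExp (N : ℕ) : ℝ := (N : ℝ) / ((N : ℝ) - 1)

theorem two_le_cast (hN : 2 ≤ N) : (2 : ℝ) ≤ N := by exact_mod_cast hN

theorem one_lt_conjExp (hN : 2 ≤ N) : 1 < conjExp N := by
  have := two_le_cast hN
  rw [conjExp, one_lt_div (by linarith)]; linarith

theorem conjExp_pos (hN : 2 ≤ N) : 0 < conjExp N := zero_lt_one.trans (one_lt_conjExp hN)

theorem sub_one_mul_conjExp (hN : 2 ≤ N) : ((N : ℝ) - 1) * conjExp N = N := by
  have := two_le_cast hN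
  rw [conjExp]; field_simp [show (N : ℝ) - 1 ≠ 0 by linarith]

theorem conjExp_sub_one_mul (hN : 2 ≤ N) : (conjExp N - 1) * ((N : ℝ) - 1) = 1 := by
  have := sub_one_mul_conjExp hN
  linarith

theorem cast_sub_one (hN : 2 ≤ N) : ((N - 1 : ℕ) : ℝ) = (N : ℝ) - 1 := by
  rw [Nat.cast_sub (by omega)]; simp

theorem rpow_conjExp_sub_one_pow (hN : 2 ≤ N) {r : ℝ} (hr : 0 ≤ r) :
    (r ^ (conjExp N - 1)) ^ (N - 1) = r := by
  rw [← Real.rpow_natCast, ← Real.rpow_mul hr, cast_sub_one hN, conjExp_sub_one_mul hN,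
    Real.rpow_one]

theorem rpow_conjExp_pow (hN : 2 ≤ N) {r : ℝ} (hr : 0 ≤ r) :
    (r ^ conjExp N) ^ (N - 1) = r ^ N := by
  rw [← Real.rpow_natCast, ← Real.rpow_mul hr, cast_sub_one hN, mul_comm, sub_one_mul_conjExp hN,
    Real.rpow_natCast]

theorem rpow_conjExp_sub_one_mul {r : ℝ} (hN : 2 ≤ N) (hr : 0 ≤ r) :
    r ^ (conjExp N - 1) * r = r ^ conjExp N := by
  rw [mul_comm, ← Real.rpow_one_add' hr (by linarith [one_lt_conjExp hN])]
  ring_nf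

theorem one_add_rpow_pos (q : ℝ) (x : EuclideanSpace ℝ (Fin N)) : 0 < 1 + ‖x‖ ^ q := by positivity

theorem ballVolume_pos (N : ℕ) : 0 < ballVolume N :=
  ENNReal.toReal_pos (Metric.measure_ball_pos _ _ one_pos).ne' measure_ball_lt_top.ne

theorem sphereArea_eq (N : ℕ) : sphereArea N = N * ballVolume N := by
  rw [sphereArea, Measure.real, Measure.toSphere_apply_univ, ENNReal.toReal_mul, ballVolume,
    Measure.real, unitBall]
  simp

theorem omegaTilde_eq (hN : 2 ≤ N) :
    omegaTilde N = (N * conjExp N) ^ (N - 1) * N ^ 2 * ballVolume N := by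
  obtain ⟨n, rfl⟩ : ∃ n, N = n + 1 := ⟨N - 1, by omega⟩
  rw [omegaTilde, sphereArea_eq, mul_pow, conjExp, Nat.add_sub_cancel]
  ring

theorem omegaTilde_pos (hN : 2 ≤ N) : 0 < omegaTilde N := by
  have := two_le_cast hN
  have := ballVolume_pos N
  have := conjExp_pos hN
  rw [omegaTilde_eq hN]; positivity

theorem muDensity_eq (x : EuclideanSpace ℝ (Fin N)) :
    muDensity N x = (ballVolume N)⁻¹ * ((1 + ‖x‖ ^ conjExp N) ^ N)⁻¹ := by
  rw [muDensity, one_div, mul_inv]; rfl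

theorem muDensity_pos (x : EuclideanSpace ℝ (Fin N)) : 0 < muDensity N x := by
  have := ballVolume_pos N
  rw [muDensity_eq]; positivity

theorem exp_vN (x : EuclideanSpace ℝ (Fin N)) : Real.exp (vN N x) = muDensity N x :=
  Real.exp_log (muDensity_pos x)

theorem vN_eq (x : EuclideanSpace ℝ (Fin N)) :
    vN N x = - Real.log (ballVolume N) - N * Real.log (1 + ‖x‖ ^ conjExp N) := by
  have := ballVolume_pos N
  rw [vN, muDensity_eq, Real.log_mul (by positivity) (by positivity), Real.log_inv, Real.log_inv,
    Real.log_pow]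
  ring

/-- The value of `v_N` on the sphere of radius `S`. -/
def vRadial (N : ℕ) (S : ℝ) : ℝ := - Real.log (ballVolume N) - N * Real.log (1 + S ^ conjExp N)

theorem vN_eq_vRadial (x : EuclideanSpace ℝ (Fin N)) : vN N x = vRadial N ‖x‖ := vN_eq x

theorem vRadial_anti (hN : 2 ≤ N) {r S : ℝ} (hr : 0 ≤ r) (h : r ≤ S) :
    vRadial N S ≤ vRadial N r := by
  have h1 : r ^ conjExp N ≤ S ^ conjExp N := Real.rpow_le_rpow hr h (conjExp_pos hN).le
  have h2 : 0 ≤ r ^ conjExp N := Real.rpow_nonneg hr _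
  have h3 := Real.log_le_log (by linarith) (add_le_add_right h1 1)
  unfold vRadial
  have : (0 : ℝ) ≤ N := N.cast_nonneg
  nlinarith

theorem continuous_muDensity (hN : 2 ≤ N) : Continuous (muDensity N) := by
  have : Continuous fun x : EuclideanSpace ℝ (Fin N) => ‖x‖ ^ conjExp N :=
    (contDiff_norm_rpow (one_lt_conjExp hN)).continuous
  rw [show muDensity N = fun x => (ballVolume N)⁻¹ * ((1 + ‖x‖ ^ conjExp N) ^ N)⁻¹ from
    funext muDensity_eq]
  exact continuous_const.mul (((continuous_const.add this).pow N).inv₀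
    fun x => (pow_pos (one_add_rpow_pos _ x) _).ne')

theorem contDiff_vN (hN : 2 ≤ N) : ContDiff ℝ 1 (vN N) := by
  rw [show vN N = _ from funext vN_eq]
  exact contDiff_const.sub (contDiff_const.mul
    ((contDiff_const.add (contDiff_norm_rpow (one_lt_conjExp hN))).log
      fun x => (one_add_rpow_pos _ x).ne'))

theorem fderiv_vN (hN : 2 ≤ N) (x y : EuclideanSpace ℝ (Fin N)) :
    fderiv ℝ (vN N) x y
      = -(N * conjExp N * ‖x‖ ^ (conjExp N - 2) / (1 + ‖x‖ ^ conjExp N)) * inner ℝ x y := by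
  have h := ((((hasFDerivAt_norm_rpow x (one_lt_conjExp hN)).const_add 1).log
    (one_add_rpow_pos _ x).ne').const_mul (N : ℝ)).const_sub (- Real.log (ballVolume N))
  rw [show vN N = _ from funext vN_eq, h.fderiv]
  simp
  ring

theorem gradient_vN (hN : 2 ≤ N) (x : EuclideanSpace ℝ (Fin N)) :
    ∇ (vN N) x = (-(N * conjExp N * ‖x‖ ^ (conjExp N - 2) / (1 + ‖x‖ ^ conjExp N))) • x :=
  ext_inner_right ℝ fun y => by
    rw [inner_gradient_left, fderiv_vN hN, real_inner_smul_left]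

theorem norm_gradient_vN (hN : 2 ≤ N) (x : EuclideanSpace ℝ (Fin N)) :
    ‖∇ (vN N) x‖ = N * conjExp N * ‖x‖ ^ (conjExp N - 1) / (1 + ‖x‖ ^ conjExp N) := by
  have hq := conjExp_pos hN
  rw [gradient_vN hN, norm_smul, norm_neg, Real.norm_of_nonneg (by positivity)]
  have : ‖x‖ ^ (conjExp N - 2) * ‖x‖ = ‖x‖ ^ (conjExp N - 1) := by
    rw [mul_comm, ← Real.rpow_one_add' (norm_nonneg _) (by linarith [one_lt_conjExp hN])]
    ring_nf
  rw [← this]; ring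

theorem norm_gradient_vN_le (hN : 2 ≤ N) (x : EuclideanSpace ℝ (Fin N)) :
    ‖∇ (vN N) x‖ ≤ N * conjExp N := by
  have hq := conjExp_pos hN
  rw [norm_gradient_vN hN, div_le_iff₀ (one_add_rpow_pos _ x)]
  refine mul_le_mul_of_nonneg_left ?_ (by positivity)
  rcases le_total ‖x‖ 1 with h | h
  · have := Real.rpow_le_one (norm_nonneg x) h (by linarith [one_lt_conjExp hN] : 0 ≤ conjExp N - 1)
    have : 0 ≤ ‖x‖ ^ conjExp N := by positivity
    linarith
  · have := Real.rpow_le_rpow_of_exponent_le h (by linarith : conjExp N - 1 ≤ conjExp N)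
    linarith

theorem lipschitzWith_vN (hN : 2 ≤ N) : ∃ C, LipschitzWith C (vN N) := by
  refine ⟨Real.toNNReal (N * conjExp N), lipschitzWith_of_nnnorm_fderiv_le
    ((contDiff_vN hN).differentiable one_ne_zero) fun x => ?_⟩
  rw [← NNReal.coe_le_coe, Real.coe_toNNReal _ (by have := conjExp_pos hN; positivity), coe_nnnorm,
    ← norm_gradient_eq]
  exact norm_gradient_vN_le hN x

theorem norm_gradient_vN_pow (hN : 2 ≤ N) (x : EuclideanSpace ℝ (Fin N)) :
    ‖∇ (vN N) x‖ ^ N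
      = (N * conjExp N) ^ N * (‖x‖ ^ conjExp N / (1 + ‖x‖ ^ conjExp N) ^ N) := by
  have h : (‖x‖ ^ (conjExp N - 1)) ^ N = ‖x‖ ^ conjExp N := by
    rw [← pow_sub_one_mul (by omega : N ≠ 0), rpow_conjExp_sub_one_pow hN (norm_nonneg x),
      mul_comm, rpow_conjExp_sub_one_mul hN (norm_nonneg x)]
  rw [norm_gradient_vN hN, div_pow, mul_pow, h, mul_div_assoc]

/-- Since $(q-1)(N-1)=1$ for the conjugate exponent $q$, the fractional power of $|x|$ in the
numerator cancels. The flux is thus a $C^1$ multiple of $x$, even at the origin, and its divergence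
can be computed classically. -/
theorem norm_gradient_vN_pow_smul (hN : 2 ≤ N) (x : EuclideanSpace ℝ (Fin N)) :
    ‖∇ (vN N) x‖ ^ (N - 2) • ∇ (vN N) x
      = (-((N * conjExp N) ^ (N - 1) * ((1 + ‖x‖ ^ conjExp N) ^ (N - 1))⁻¹)) • x := by
  rcases eq_or_ne x 0 with rfl | hx
  · simp [gradient_vN hN]
  have hr : 0 < ‖x‖ := norm_pos_iff.2 hx
  have h1 : ‖x‖ ^ (conjExp N - 2) = ‖x‖ ^ (conjExp N - 1) / ‖x‖ := by
    rw [show conjExp N - 2 = conjExp N - 1 - 1 by ring, Real.rpow_sub_one hr.ne']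
  have h2 := rpow_conjExp_sub_one_pow hN hr.le
  have hp := one_add_rpow_pos (conjExp N) x
  rw [norm_gradient_vN hN, gradient_vN hN, smul_smul, h1]
  obtain ⟨n, hn⟩ : ∃ n, N - 2 = n := ⟨_, rfl⟩
  rw [show N - 1 = n + 1 by omega] at h2 ⊢
  rw [hn]
  congr 1
  rw [pow_succ] at h2
  rw [div_pow, mul_pow, mul_neg, neg_inj]
  calc _ = ((N * conjExp N) ^ (n + 1) * ((1 + ‖x‖ ^ conjExp N) ^ (n + 1))⁻¹)
        * ((‖x‖ ^ (conjExp N - 1)) ^ n * ‖x‖ ^ (conjExp N - 1) / ‖x‖) := by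
        rw [pow_succ, pow_succ]; field_simp
    _ = _ := by rw [h2, div_self hr.ne', mul_one]

/-! ### Integration against $\mu_N$ and the divergence of the radial flux -/

theorem integral_muMeasure (hN : 2 ≤ N) (u : EuclideanSpace ℝ (Fin N) → ℝ) :
    ∫ x, u x ∂(muMeasure N) = ∫ x, muDensity N x * u x := by
  rw [muMeasure, integral_withDensity_eq_integral_toReal_smul
    (continuous_muDensity hN).measurable.ennreal_ofReal (by simp)]
  simp [ENNReal.toReal_ofReal (muDensity_pos _).le]

theorem integrable_muMeasure_iff (hN : 2 ≤ N) {u : EuclideanSpace ℝ (Fin N) → ℝ} :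
    Integrable u (muMeasure N) ↔ Integrable (fun x => muDensity N x * u x) volume := by
  rw [muMeasure, integrable_withDensity_iff_integrable_smul'
    (continuous_muDensity hN).measurable.ennreal_ofReal (by simp)]
  simp [ENNReal.toReal_ofReal (muDensity_pos _).le]

theorem inv_pow_sq_mul_pow (hN : 2 ≤ N) {p : ℝ} (hp : 0 < p) :
    ((p ^ (N - 1)) ^ 2)⁻¹ * p ^ (N - 1 - 1) = (p ^ N)⁻¹ := by
  obtain ⟨n, rfl⟩ : ∃ n, N = n + 2 := ⟨N - 2, by omega⟩
  rw [show n + 2 - 1 - 1 = n by omega, show n + 2 - 1 = n + 1 by omega]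
  field_simp
  ring

/-- The radial field `x / (1 + |x|^q)^(N-1)` has divergence `N / (1 + |x|^q)^N`. -/
theorem integral_radial_inner_gradient (hN : 2 ≤ N) {z : EuclideanSpace ℝ (Fin N) → ℝ} {C : NNReal}
    (hz : LipschitzWith C z) (hzc : HasCompactSupport z) :
    ∫ x, ((1 + ‖x‖ ^ conjExp N) ^ (N - 1))⁻¹ * inner ℝ x (∇ z x)
      = - ∫ x, (N * ((1 + ‖x‖ ^ conjExp N) ^ N)⁻¹) * z x := by
  set a : EuclideanSpace ℝ (Fin N) → ℝ := fun x => ((1 + ‖x‖ ^ conjExp N) ^ (N - 1))⁻¹ with ha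
  have had : ContDiff ℝ 1 a :=
    ((contDiff_const.add (contDiff_norm_rpow (one_lt_conjExp hN))).pow _).inv
      fun x => (pow_pos (one_add_rpow_pos _ x) _).ne'
  have hfa : ∀ x y, fderiv ℝ a x y
      = -(N * ‖x‖ ^ (conjExp N - 2) * ((1 + ‖x‖ ^ conjExp N) ^ N)⁻¹) * inner ℝ x y := by
    intro x y
    have hp := one_add_rpow_pos (conjExp N) x
    have h1 := ((hasFDerivAt_norm_rpow x (one_lt_conjExp hN)).const_add 1).pow (N - 1)
    have h2 := (hasDerivAt_inv (pow_pos hp (N - 1)).ne').comp_hasFDerivAt x h1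
    have h3 : fderiv ℝ a x = _ := h2.fderiv
    rw [h3]
    simp only [smul_apply, smul_eq_mul, innerSL_apply_apply, nsmul_eq_mul, cast_sub_one hN]
    rw [← inv_pow_sq_mul_pow hN hp]
    linear_combination (-(((1 + ‖x‖ ^ conjExp N) ^ (N - 1)) ^ 2)⁻¹
      * (1 + ‖x‖ ^ conjExp N) ^ (N - 1 - 1) * ‖x‖ ^ (conjExp N - 2) * inner ℝ x y)
      * sub_one_mul_conjExp hN
  let e : Fin N → EuclideanSpace ℝ (Fin N) := fun i => EuclideanSpace.single i (1 : ℝ)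
  have hsum : ∀ (ℓ : EuclideanSpace ℝ (Fin N) →L[ℝ] ℝ) (x : EuclideanSpace ℝ (Fin N)),
      ∑ i, x i * ℓ (e i) = ℓ x := by
    intro ℓ x
    conv_rhs => rw [← (EuclideanSpace.basisFun (Fin N) ℝ).sum_repr x]
    simp [map_sum, e]
  have hcoord : ∀ i, ContDiff ℝ 1 fun x : EuclideanSpace ℝ (Fin N) => x i := fun i => by fun_prop
  have hfc : ∀ i x, fderiv ℝ (fun x => a x * x i) x (e i)
      = a x + x i * fderiv ℝ a x (e i) := by
    intro i x
    have h1 : HasFDerivAt (fun x : EuclideanSpace ℝ (Fin N) => x i)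
      (EuclideanSpace.proj i : EuclideanSpace ℝ (Fin N) →L[ℝ] ℝ) x :=
      (EuclideanSpace.proj i : EuclideanSpace ℝ (Fin N) →L[ℝ] ℝ).hasFDerivAt
    have h2 := ((had.differentiable one_ne_zero) x).hasFDerivAt.mul h1
    have h3 : fderiv ℝ (fun x => a x * x i) x = _ := h2.fderiv
    rw [h3]
    simp [e]
  have i1 : ∀ i, Integrable (fun x => fderiv ℝ z x (e i) * (a x * x i)) volume := by
    intro i
    have hloc : LocallyIntegrable (fun x => fderiv ℝ z x (e i)) volume := by
      refine (locallyIntegrable_const ((C : ℝ) * ‖e i‖)).mono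
        ((measurable_fderiv_apply_const ℝ z (e i)).aestronglyMeasurable)
        (Eventually.of_forall fun x => ?_)
      rw [Real.norm_of_nonneg (mul_nonneg C.coe_nonneg (norm_nonneg _))]
      exact ((fderiv ℝ z x).le_opNorm _).trans
        (mul_le_mul_of_nonneg_right (norm_fderiv_le_of_lipschitz ℝ hz) (norm_nonneg _))
    refine (integrableOn_iff_integrable_of_support_subset fun x hx => ?_).1
      ((hloc.integrableOn_isCompact hzc).mul_continuousOn
        (had.mul (hcoord i)).continuous.continuousOn hzc)
    by_contra hx'
    refine hx ?_
    have h0 : fderiv ℝ z x = 0 := by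
      by_contra h
      exact hx' (support_fderiv_subset ℝ h)
    simp [h0]
  have i2 : ∀ i, Integrable (fun x => fderiv ℝ (fun x => a x * x i) x (e i) * z x) volume := by
    intro i
    refine Continuous.integrable_of_hasCompactSupport ?_ hzc.mul_left
    exact (((had.mul (hcoord i)).continuous_fderiv one_ne_zero).clm_apply continuous_const).mul
      hz.continuous
  have e1 : ∀ x, a x * inner ℝ x (∇ z x) = ∑ i, fderiv ℝ z x (e i) * (a x * x i) := by
    intro x
    rw [inner_gradient_right, conj_trivial, ← hsum (fderiv ℝ z x) x, Finset.mul_sum]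
    exact Finset.sum_congr rfl fun i _ => by ring
  -- With $a=(1+r^q)^{-(N-1)}$ the divergence of $a\,x$ is $Na+x\cdot\nabla a$. Over the common
  -- denominator $(1+r^q)^N$ the terms in $r^q$ cancel, because $(N-1)q=N$.
  have e2 : ∀ x, (N * ((1 + ‖x‖ ^ conjExp N) ^ N)⁻¹) * z x
      = ∑ i, fderiv ℝ (fun x => a x * x i) x (e i) * z x := by
    intro x
    have hp := one_add_rpow_pos (conjExp N) x
    rw [← Finset.sum_mul]
    simp_rw [hfc]
    rw [Finset.sum_add_distrib, hsum, hfa, real_inner_self_eq_norm_sq]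
    have h3 : ‖x‖ ^ (conjExp N - 2) * ‖x‖ ^ 2 = ‖x‖ ^ conjExp N := by
      rw [← Real.rpow_natCast, ← Real.rpow_add' (norm_nonneg _) (by have := conjExp_pos hN; simp; linarith)]
      simp
    have h4 : a x = (1 + ‖x‖ ^ conjExp N) * ((1 + ‖x‖ ^ conjExp N) ^ N)⁻¹ := by
      obtain ⟨n, hn⟩ : ∃ n, N - 1 = n := ⟨_, rfl⟩
      rw [ha, hn]
      have : (1 + ‖x‖ ^ conjExp N) ^ N = (1 + ‖x‖ ^ conjExp N) ^ n * (1 + ‖x‖ ^ conjExp N) := by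
        rw [← pow_succ]; congr 1; omega
      simp only [this]
      field_simp
    congr 1
    simp only [Finset.sum_const, Finset.card_univ, Fintype.card_fin, nsmul_eq_mul]
    rw [h4]
    linear_combination (N * ((1 + ‖x‖ ^ conjExp N) ^ N)⁻¹) * h3
  refine ((integral_congr_ae (Eventually.of_forall e1)).trans ?_).trans
    (congrArg Neg.neg (integral_congr_ae (Eventually.of_forall e2))).symm
  rw [integral_finsetSum _ fun i _ => i1 i, integral_finsetSum _ fun i _ => i2 i,
    ← Finset.sum_neg_distrib]
  exact Finset.sum_congr rfl fun i _ => integral_fderiv_mul_eq_neg (had.mul (hcoord i)) hz hzc (e i)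

/-! ### The energy of `v_N` on balls -/

/-- A primitive of `T ↦ T ^ m / (1 + T) ^ (m + 1)`. -/
def energyPrimitive (m : ℕ) (T : ℝ) : ℝ :=
  Real.log (1 + T) - ∑ k ∈ Finset.Icc 1 m, (T / (1 + T)) ^ k / k

/-- With $\sigma=T/(1+T)$ and $\sigma'=(1+T)^{-2}$, each new term $-\sigma^{m+1}/(m+1)$ contributes
$-T^m/(1+T)^{m+2}$, which raises the exponent $m$ by one. The harmonic sum of the theorem originates
in these denominators. -/
theorem hasDerivAt_energyPrimitive (m : ℕ) {T : ℝ} (hT : 0 ≤ T) :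
    HasDerivAt (energyPrimitive m) (T ^ m / (1 + T) ^ (m + 1)) T := by
  have hp : 0 < 1 + T := by linarith
  have h1 : HasDerivAt (fun T : ℝ => 1 + T) 1 T := (hasDerivAt_id T).const_add 1
  induction m with
  | zero =>
    have h2 := h1.log hp.ne'
    have e : energyPrimitive 0 = fun T : ℝ => Real.log (1 + T) := by ext; simp [energyPrimitive]
    rw [e]
    simpa using h2
  | succ m ih =>
    have e : energyPrimitive (m + 1) = fun T : ℝ =>
        energyPrimitive m T - (T / (1 + T)) ^ (m + 1) / ((m + 1 : ℕ) : ℝ) := by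
      ext T
      simp only [energyPrimitive]
      rw [Finset.sum_Icc_succ_top (by omega)]
      ring
    have h3 := ((((hasDerivAt_id T).div h1 hp.ne').pow (m + 1)).div_const ((m + 1 : ℕ) : ℝ))
    rw [e]
    refine (ih.sub h3).congr_deriv ?_
    have hm : ((m + 1 : ℕ) : ℝ) ≠ 0 := by positivity
    simp only [id, Pi.div_apply, Nat.add_sub_cancel, div_pow]
    field_simp
    ring

/-- The energy `(1 / ω̃_N) ∫_{B_S} |∇ v_N|^N`, in closed form. -/
def ballEnergy (N : ℕ) (S : ℝ) : ℝ := energyPrimitive (N - 1) (S ^ conjExp N)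

theorem integral_ball_fun_norm (hN : 2 ≤ N) (f : ℝ → ℝ) (S : ℝ) (hS : 0 ≤ S) :
    ∫ x in Metric.ball (0 : EuclideanSpace ℝ (Fin N)) S, f ‖x‖
      = N * ballVolume N * ∫ r in (0 : ℝ)..S, r ^ (N - 1) * f r := by
  have : Nonempty (Fin N) := ⟨⟨0, by omega⟩⟩
  have h := integral_fun_norm_addHaar (volume : Measure (EuclideanSpace ℝ (Fin N)))
    (Set.indicator (Set.Iio S) f)
  rw [← integral_indicator Metric.isOpen_ball.measurableSet]
  have e1 : (Metric.ball (0 : EuclideanSpace ℝ (Fin N)) S).indicator (fun x => f ‖x‖)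
      = fun x => Set.indicator (Set.Iio S) f ‖x‖ := by
    ext x
    simp [Set.indicator]
  rw [e1, h, finrank_euclideanSpace_fin, intervalIntegral.integral_of_le hS,
    integral_Ioc_eq_integral_Ioo]
  have e2 : (fun y : ℝ => y ^ (N - 1) • Set.indicator (Set.Iio S) f y)
      = Set.indicator (Set.Iio S) fun y => y ^ (N - 1) * f y := by
    ext y
    by_cases hy : y < S <;> simp [hy]
  rw [e2, setIntegral_indicator measurableSet_Iio, Set.Ioi_inter_Iio]
  simp [ballVolume, unitBall, mul_assoc]

theorem continuous_rpow_conjExp (hN : 2 ≤ N) : Continuous fun r : ℝ => r ^ conjExp N :=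
  continuous_id.rpow_const fun _ => Or.inr (conjExp_pos hN).le

/-- Polar coordinates followed by $T=r^q$ turn the radial integrand into $T^{N-1}/(1+T)^N$, up to
constants that combine to $\widetilde{\omega_N}$. -/
theorem integral_ball_norm_gradient_vN_pow (hN : 2 ≤ N) {S : ℝ} (hS : 0 ≤ S) :
    ∫ x in Metric.ball (0 : EuclideanSpace ℝ (Fin N)) S, ‖∇ (vN N) x‖ ^ N
      = omegaTilde N * ballEnergy N S := by
  simp_rw [norm_gradient_vN_pow hN]
  rw [integral_ball_fun_norm hN
    (fun r => (N * conjExp N) ^ N * (r ^ conjExp N / (1 + r ^ conjExp N) ^ N)) S hS]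
  have hq := one_lt_conjExp hN
  have hcont : ContinuousOn (fun r => ballEnergy N r) (Set.Icc 0 S) := by
    intro r hr
    have h1 := (hasDerivAt_energyPrimitive (N - 1)
      (Real.rpow_nonneg hr.1 (conjExp N))).continuousAt
    exact (h1.comp (f := fun r : ℝ => r ^ conjExp N)
      (continuous_rpow_conjExp hN).continuousAt).continuousWithinAt
  have hderiv : ∀ r ∈ Set.Ioo 0 S, HasDerivAt (fun r => ballEnergy N r)
      (conjExp N * (r ^ (N - 1) * (r ^ conjExp N / (1 + r ^ conjExp N) ^ N))) r := by
    intro r hr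
    have h1 := hasDerivAt_energyPrimitive (N - 1) (Real.rpow_nonneg hr.1.le (conjExp N))
    have h2 := h1.comp r (Real.hasDerivAt_rpow_const (p := conjExp N) (Or.inl hr.1.ne'))
    refine h2.congr_deriv ?_
    rw [rpow_conjExp_pow hN hr.1.le, show N - 1 + 1 = N by omega,
      ← rpow_conjExp_sub_one_mul hN hr.1.le, ← pow_sub_one_mul (by omega : N ≠ 0) r]
    ring
  have hint : IntervalIntegrable
      (fun r => conjExp N * (r ^ (N - 1) * (r ^ conjExp N / (1 + r ^ conjExp N) ^ N)))
      volume 0 S := by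
    refine ContinuousOn.intervalIntegrable ?_
    rw [Set.uIcc_of_le hS]
    have hc := (continuous_rpow_conjExp hN).continuousOn (s := Set.Icc 0 S)
    refine continuousOn_const.mul ((continuousOn_id.pow _).mul
      (hc.div ((continuousOn_const.add hc).pow _) fun r hr => ?_))
    have := Real.rpow_nonneg hr.1 (conjExp N)
    positivity
  have h := intervalIntegral.integral_eq_sub_of_hasDerivAt_of_le hS hcont hderiv hint
  have h0 : ballEnergy N 0 = 0 := by
    rw [ballEnergy, Real.zero_rpow (by linarith), energyPrimitive]
    simp only [add_zero, Real.log_one, zero_div, zero_sub, neg_eq_zero]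
    refine Finset.sum_eq_zero fun k hk => ?_
    rw [zero_pow (by have := (Finset.mem_Icc.1 hk).1; omega), zero_div]
  rw [h0, sub_zero, intervalIntegral.integral_const_mul] at h
  rw [← h, omegaTilde_eq hN]
  have e : ∀ r : ℝ, r ^ (N - 1) * ((N * conjExp N) ^ N * (r ^ conjExp N / (1 + r ^ conjExp N) ^ N))
      = (N * conjExp N) ^ N * (r ^ (N - 1) * (r ^ conjExp N / (1 + r ^ conjExp N) ^ N)) :=
    fun r => by ring
  simp_rw [e]
  rw [intervalIntegral.integral_const_mul, ← pow_sub_one_mul (by omega : N ≠ 0) (N * conjExp N)]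
  ring

/-- The defect between the functionals `I` and `J` when the plane is cut off at radius `S`. -/
def ballDefect (N : ℕ) (S : ℝ) : ℝ :=
  ballEnergy N S + vRadial N S + Real.log (ballVolume N) + N * Real.log S

/-- Since $N\ln S=(N-1)\ln T$ for $T=S^q$, all divergent logarithms collect into
$(N-1)\ln\frac{T}{1+T}$, which tends to zero. Only the finite sum survives, evaluated at $\sigma=1$.
-/
theorem tendsto_ballDefect (hN : 2 ≤ N) :
    Tendsto (ballDefect N) atTop (𝓝 (-∑ k ∈ Finset.Icc 1 (N - 1), (1 : ℝ) / k)) := by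
  have hT : Tendsto (fun S : ℝ => S ^ conjExp N) atTop atTop := tendsto_rpow_atTop (conjExp_pos hN)
  have hσ : Tendsto (fun S : ℝ => S ^ conjExp N / (1 + S ^ conjExp N)) atTop (𝓝 1) := by
    have h1 : Tendsto (fun S : ℝ => 1 - (1 + S ^ conjExp N)⁻¹) atTop (𝓝 (1 - 0)) :=
      tendsto_const_nhds.sub (tendsto_inv_atTop_zero.comp (tendsto_atTop_add_const_left _ 1 hT))
    rw [sub_zero] at h1
    refine h1.congr' ?_
    filter_upwards [eventually_gt_atTop 0] with S hS
    have : 0 < 1 + S ^ conjExp N := by positivity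
    field_simp
    ring
  have hF : Tendsto (fun σ : ℝ => ((N : ℝ) - 1) * Real.log σ
      - ∑ k ∈ Finset.Icc 1 (N - 1), σ ^ k / k) (𝓝 1)
      (𝓝 (((N : ℝ) - 1) * Real.log 1 - ∑ k ∈ Finset.Icc 1 (N - 1), (1 : ℝ) ^ k / k)) := by
    refine Tendsto.sub (tendsto_const_nhds.mul (Real.continuousAt_log one_ne_zero)) ?_
    refine tendsto_finsetSum _ fun k _ => ?_
    exact (continuous_pow k).continuousAt.tendsto.div_const _
  have h := hF.comp hσ
  simp only [Real.log_one, mul_zero, zero_sub, one_pow] at h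
  refine h.congr' ?_
  filter_upwards [eventually_gt_atTop 0] with S hS
  have h1 : 0 < S ^ conjExp N := by positivity
  have h2 : Real.log S = Real.log (S ^ conjExp N) / conjExp N := by
    rw [Real.log_rpow hS]; field_simp [(conjExp_pos hN).ne']
  have h3 : (N : ℝ) / conjExp N = N - 1 := by
    rw [div_eq_iff (conjExp_pos hN).ne', sub_one_mul_conjExp hN]
  simp only [Function.comp_apply, ballDefect, ballEnergy, energyPrimitive, vRadial]
  rw [Real.log_div h1.ne' (by positivity), h2]
  linear_combination -(Real.log (S ^ conjExp N)) * h3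

/-! ### The equation for $v_N$ and the comparison of energies -/

/-- The weak form of `-Δ_N v_N = (ω̃_N / N) μ_N`. -/
theorem integral_flux_gradient (hN : 2 ≤ N) {z : EuclideanSpace ℝ (Fin N) → ℝ} {C : NNReal}
    (hz : LipschitzWith C z) (hzc : HasCompactSupport z) :
    ∫ x, N * ‖∇ (vN N) x‖ ^ (N - 2) * inner ℝ (∇ (vN N) x) (∇ z x)
      = omegaTilde N * ∫ x, z x ∂(muMeasure N) := by
  have e : ∀ x, N * ‖∇ (vN N) x‖ ^ (N - 2) * inner ℝ (∇ (vN N) x) (∇ z x)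
      = -(N * (N * conjExp N) ^ (N - 1)) *
        (((1 + ‖x‖ ^ conjExp N) ^ (N - 1))⁻¹ * inner ℝ x (∇ z x)) := by
    intro x
    rw [mul_assoc, ← real_inner_smul_left, norm_gradient_vN_pow_smul hN, real_inner_smul_left]
    ring
  simp_rw [e]
  rw [integral_const_mul, integral_radial_inner_gradient hN hz hzc, integral_muMeasure hN,
    neg_mul_neg, omegaTilde_eq hN, ← integral_const_mul, ← integral_const_mul]
  congr 1; ext x
  have := (ballVolume_pos N).ne'
  rw [muDensity_eq]
  field_simp

/-- The function `z + (v_N - v_N(S))₊`. -/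
def addCap (z : EuclideanSpace ℝ (Fin N) → ℝ) (S : ℝ) (x : EuclideanSpace ℝ (Fin N)) : ℝ :=
  z x + max (vN N x - vRadial N S) 0

theorem cap_eq_of_le (hN : 2 ≤ N) {S : ℝ} {x : EuclideanSpace ℝ (Fin N)} (hx : ‖x‖ ≤ S) :
    max (vN N x - vRadial N S) 0 = vN N x - vRadial N S :=
  max_eq_left (by rw [vN_eq_vRadial]; linarith [vRadial_anti hN (norm_nonneg x) hx])

theorem cap_eq_zero_of_ge (hN : 2 ≤ N) {S : ℝ} (hS : 0 ≤ S) {x : EuclideanSpace ℝ (Fin N)}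
    (hx : S ≤ ‖x‖) : max (vN N x - vRadial N S) 0 = 0 :=
  max_eq_right (by rw [vN_eq_vRadial]; linarith [vRadial_anti hN hS hx])

theorem lipschitzWith_cap (hN : 2 ≤ N) (S : ℝ) :
    ∃ C, LipschitzWith C fun x : EuclideanSpace ℝ (Fin N) => max (vN N x - vRadial N S) 0 := by
  obtain ⟨C, hC⟩ := lipschitzWith_vN hN
  exact ⟨_, (hC.sub (LipschitzWith.const (vRadial N S))).max_const 0⟩

theorem gradient_addCap_of_lt (hN : 2 ≤ N) {z : EuclideanSpace ℝ (Fin N) → ℝ} {S : ℝ}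
    {x : EuclideanSpace ℝ (Fin N)} (hz : DifferentiableAt ℝ z x) (hx : ‖x‖ < S) :
    ∇ (addCap z S) x = ∇ (vN N) x + ∇ z x := by
  have h : addCap z S =ᶠ[𝓝 x] fun y => z y + (vN N y + -vRadial N S) := by
    filter_upwards [(isOpen_lt continuous_norm continuous_const).mem_nhds hx] with y hy
    rw [addCap, cap_eq_of_le hN (le_of_lt hy), sub_eq_add_neg]
  have hv := ((contDiff_vN hN).differentiable one_ne_zero) x
  rw [h.gradient_eq, gradient_fun_add hz (hv.add_const _),
    gradient_fun_add hv (differentiableAt_const _), gradient_fun_const, add_zero, add_comm]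

theorem addCap_eq_zero (hN : 2 ≤ N) {z : EuclideanSpace ℝ (Fin N) → ℝ} {S : ℝ} (hS : 0 ≤ S)
    (hz : ∀ x, S < ‖x‖ → z x = 0) (x : EuclideanSpace ℝ (Fin N)) (hx : S < ‖x‖) :
    addCap z S x = 0 := by
  rw [addCap, hz x hx, cap_eq_zero_of_ge hN hS hx.le, add_zero]

/-- This is the definition of the remainder integrated over $B_S$: the first-order term is evaluated
by the weak equation for $v_N$ tested with `z`, the zeroth-order term by the closed form of the
energy. It links the energy in $I$ to that in $J$. -/
theorem integral_norm_gradient_addCap (hN : 2 ≤ N) {z : EuclideanSpace ℝ (Fin N) → ℝ} {C : NNReal}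
    (hz : LipschitzWith C z) {S : ℝ} (hS : 0 ≤ S) (hz0 : ∀ x, S < ‖x‖ → z x = 0) :
    ∫ x, ‖∇ (addCap z S) x‖ ^ N
      = (∫ x, remainder N (∇ (vN N) x) (∇ z x)) + omegaTilde N * ∫ x, z x ∂(muMeasure N)
        + omegaTilde N * ballEnergy N S := by
  have hzc : HasCompactSupport z := hasCompactSupport_of_norm_gt hz0
  have hgz : ∀ x, S < ‖x‖ → ∇ z x = 0 := fun x hx =>
    gradient_of_eventuallyEq_const (eq_zero_nhds_of_norm_gt hz0 hx)
  have hmv := measurable_gradient (vN N)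
  have hmz := measurable_gradient z
  have bz := norm_gradient_le_of_lipschitz hz
  have bv := norm_gradient_vN_le hN
  have hq := conjExp_pos hN
  obtain ⟨K, hK, hR⟩ := abs_remainder_le hN
  have i1 : Integrable (fun x => remainder N (∇ (vN N) x) (∇ z x)) volume := by
    refine integrable_of_bounded_of_norm_gt (S := S)
      (C := K * ((N * conjExp N) ^ (N - 2) * (C : ℝ) ^ 2 + (C : ℝ) ^ N))
      ((continuous_remainder N).measurable.comp (hmv.prodMk hmz)).aestronglyMeasurable
      (fun x => ?_) fun x hx => by rw [hgz x hx, remainder_zero_right]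
    refine (hR _ _).trans ?_
    have := bz x
    have := bv x
    gcongr
  have i2 : Integrable (fun x => N * ‖∇ (vN N) x‖ ^ (N - 2) * inner ℝ (∇ (vN N) x) (∇ z x))
      volume := by
    refine integrable_of_bounded_of_norm_gt (S := S)
      (C := N * (N * conjExp N) ^ (N - 2) * ((N * conjExp N) * C))
      (((hmv.norm.pow_const _).const_mul _).mul (hmv.inner hmz)).aestronglyMeasurable
      (fun x => ?_) fun x hx => by rw [hgz x hx, inner_zero_right, mul_zero]
    rw [norm_mul, Real.norm_of_nonneg (by positivity)]
    have := bz x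
    have := bv x
    have := norm_inner_le_norm (𝕜 := ℝ) (∇ (vN N) x) (∇ z x)
    have : ‖(inner ℝ (∇ (vN N) x) (∇ z x) : ℝ)‖ ≤ N * conjExp N * C := this.trans (by gcongr)
    gcongr
  have i3 : Integrable ((Metric.ball (0 : EuclideanSpace ℝ (Fin N)) S).indicator
      fun x => ‖∇ (vN N) x‖ ^ N) volume := by
    refine integrable_of_bounded_of_norm_gt (S := S) (C := (N * conjExp N) ^ N)
      ((hmv.norm.pow_const _).indicator Metric.isOpen_ball.measurableSet).aestronglyMeasurable
      (fun x => ?_) fun x hx => Set.indicator_of_notMem (by simpa using hx.le) _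
    refine (norm_indicator_le_norm_self _ _).trans ?_
    rw [norm_pow, norm_norm]
    have := bv x
    gcongr
  rw [← integral_flux_gradient hN hz hzc, ← integral_ball_norm_gradient_vN_pow hN hS,
    ← integral_indicator Metric.isOpen_ball.measurableSet, ← integral_add i1 i2,
    ← integral_add (by exact i1.add i2) i3]
  refine integral_congr_ae ?_
  -- The cap has a kink on the sphere of radius `S`, which is null.
  filter_upwards [ae_norm_ne (by omega : N ≠ 0) S, hz.ae_differentiableAt (μ := volume)]
    with x hx hzd
  rcases lt_or_gt_of_ne hx with h | h
  · rw [gradient_addCap_of_lt hN hzd h, Set.indicator_of_mem (by simpa using h), remainder]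
    ring
  · have h0 : ∇ (addCap z S) x = 0 :=
      gradient_of_eventuallyEq_const (eq_zero_nhds_of_norm_gt (addCap_eq_zero hN hS hz0) h)
    rw [h0, hgz x h, remainder_zero_right, inner_zero_right,
      Set.indicator_of_notMem (by simpa using h.le)]
    simp; omega

/-! ### Exponential form of the lower bounds -/

/-- The lower bound `m ≤ I` on `W_{μ_N}`, exponentiated. -/
def OnofriBound (N : ℕ) (m : ℝ) : Prop :=
  ∀ u ∈ weightedSobolev N, ∫⁻ x, ENNReal.ofReal (Real.exp (u x)) ∂(muMeasure N) ≤
    ENNReal.ofReal (Real.exp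
      ((1 / omegaTilde N) * (∫ x, HN N u x) + ∫ x, u x ∂(muMeasure N) - m))

/-- The lower bound `m ≤ J` on `W₀^{1,N}(B₁)`, exponentiated. -/
def CarlesonChangBound (N : ℕ) (m : ℝ) : Prop :=
  ∀ u ∈ sobolevW10 (N : ℝ≥0∞) (unitBall N),
    ∫⁻ x in unitBall N, ENNReal.ofReal (Real.exp (u x)) ≤
      ENNReal.ofReal (Real.exp
        ((1 / omegaTilde N) * (∫ x in unitBall N, ‖weakGradient (unitBall N) u x‖ ^ N) - m
          + Real.log (ballVolume N)))

/-- No finiteness is needed: for `X = ⊤` both sides fail, for `X = 0` both hold. -/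
theorem coe_le_coe_sub_log_iff (m P : ℝ) (X : ℝ≥0∞) :
    (m : EReal) ≤ (P : EReal) - ENNReal.log X ↔ X ≤ ENNReal.ofReal (Real.exp (P - m)) := by
  induction X with
  | top => simp
  | coe t =>
    rcases eq_or_ne t 0 with rfl | ht
    · simp
    · have ht' : 0 < (t : ℝ) := by positivity
      rw [ENNReal.log_of_nnreal ht, ← EReal.coe_sub, EReal.coe_le_coe_iff,
        ← ENNReal.ofReal_coe_nnreal, ENNReal.ofReal_le_ofReal_iff (Real.exp_pos _).le,
        ← Real.log_le_iff_le_exp ht']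
      constructor <;> intro h <;> linarith

theorem coe_le_iInf_functionalI_iff (N : ℕ) (m : ℝ) :
    (m : EReal) ≤ (⨅ u ∈ weightedSobolev N, functionalI N u) ↔ OnofriBound N m := by
  simp only [le_iInf_iff, OnofriBound, functionalI, coe_le_coe_sub_log_iff]

theorem coe_le_iInf_functionalJ_iff (N : ℕ) (m : ℝ) :
    (m : EReal) ≤ (⨅ u ∈ sobolevW10 (N : ℝ≥0∞) (unitBall N), functionalJ N u) ↔
      CarlesonChangBound N m := by
  simp only [le_iInf_iff, CarlesonChangBound, functionalJ, coe_le_coe_sub_log_iff]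
  refine forall₂_congr fun u _ => ?_
  have hV := ballVolume_pos N
  have h1 : ENNReal.ofReal (1 / ballVolume N) = (ENNReal.ofReal (ballVolume N))⁻¹ := by
    rw [one_div, ENNReal.ofReal_inv_of_pos hV]
  rw [h1, mul_comm, ← div_eq_mul_inv, ENNReal.div_le_iff (by simpa using hV) (by simp),
    Real.exp_add _ (Real.log _), Real.exp_log hV, ENNReal.ofReal_mul (Real.exp_pos _).le]

/-- Reals are order dense in the extended reals, so comparing real lower bounds also covers infinite
infima. -/
theorem ereal_eq_of_forall_coe_le_iff {a b : EReal} (h : ∀ m : ℝ, (m : EReal) ≤ a ↔ (m : EReal) ≤ b) :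
    a = b := by
  have key : ∀ {a b : EReal}, (∀ m : ℝ, (m : EReal) ≤ a → (m : EReal) ≤ b) → a ≤ b := by
    intro a b h
    refine le_of_forall_lt fun c hc => ?_
    obtain ⟨q, h1, h2⟩ := EReal.lt_iff_exists_real_btwn.1 hc
    exact h1.trans_le (h q h2.le)
  exact le_antisymm (key fun m => (h m).1) (key fun m => (h m).2)

theorem coe_le_add_coe_iff (m H : ℝ) (b : EReal) :
    (m : EReal) ≤ b + (H : EReal) ↔ ((m - H : ℝ) : EReal) ≤ b := by
  induction b with
  | bot => simp [-EReal.coe_sub]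
  | top => simp
  | coe b =>
    rw [← EReal.coe_add, EReal.coe_le_coe_iff, EReal.coe_le_coe_iff]
    constructor <;> intro h <;> linarith

/-- Fatou's lemma for exponential integrals. -/
theorem lintegral_exp_le_of_tendsto {α : Type*} [MeasurableSpace α] {μ : Measure α}
    {X : ℕ → α → ℝ} {Y : α → ℝ} {P : ℕ → ℝ} {p : ℝ} (hm : ∀ n, AEMeasurable (X n) μ)
    (hX : ∀ᵐ x ∂μ, Tendsto (fun n => X n x) atTop (𝓝 (Y x)))
    (hP : Tendsto P atTop (𝓝 p))
    (h : ∀ᶠ n in atTop, ∫⁻ x, ENNReal.ofReal (Real.exp (X n x)) ∂μ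
      ≤ ENNReal.ofReal (Real.exp (P n))) :
    ∫⁻ x, ENNReal.ofReal (Real.exp (Y x)) ∂μ ≤ ENNReal.ofReal (Real.exp p) := by
  have h1 : ∫⁻ x, ENNReal.ofReal (Real.exp (Y x)) ∂μ
      = ∫⁻ x, liminf (fun n => ENNReal.ofReal (Real.exp (X n x))) atTop ∂μ := by
    refine lintegral_congr_ae ?_
    filter_upwards [hX] with x hx
    exact (ENNReal.tendsto_ofReal
      ((Real.continuous_exp.tendsto _).comp hx)).liminf_eq.symm
  have h2 : Tendsto (fun n => ENNReal.ofReal (Real.exp (P n))) atTop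
      (𝓝 (ENNReal.ofReal (Real.exp p))) :=
    ENNReal.tendsto_ofReal ((Real.continuous_exp.tendsto _).comp hP)
  rw [h1, ← h2.liminf_eq]
  exact (lintegral_liminf_le' fun n =>
    ENNReal.measurable_ofReal.comp_aemeasurable (Real.measurable_exp.comp_aemeasurable (hm n))).trans
    (liminf_le_liminf h)

/-! ### Test functions -/

theorem lipschitz_mem_weightedSobolev (hN : 2 ≤ N) {z : EuclideanSpace ℝ (Fin N) → ℝ} {C : NNReal}
    (hz : LipschitzWith C z) (hzc : HasCompactSupport z) :
    z ∈ weightedSobolev N ∧ weakGradient Set.univ z =ᵐ[volume] ∇ z := by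
  have hw := hasWeakGradient_of_lipschitz hz hzc
  have hae : weakGradient Set.univ z =ᵐ[volume] ∇ z := by
    simpa using hw.weakGradient_ae_eq isOpen_univ
  have hgc : HasCompactSupport (∇ z) :=
    (hzc.fderiv ℝ).comp_left (map_zero (InnerProductSpace.toDual ℝ _).symm)
  have hmz := measurable_gradient z
  have hmv := measurable_gradient (vN N)
  have bz := norm_gradient_le_of_lipschitz hz
  refine ⟨⟨?_, ⟨_, hw⟩, ?_, ?_⟩, hae⟩
  · rw [integrable_muMeasure_iff hN]
    exact ((continuous_muDensity hN).mul hz.continuous).integrable_of_hasCompactSupport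
      hzc.mul_left
  · rw [memLp_congr_ae hae]
    exact hgc.memLp_of_bound hmz.aestronglyMeasurable C (Eventually.of_forall bz)
  · have h1 : MemLp (fun x => ‖∇ z x‖ ^ 2 * ‖∇ (vN N) x‖ ^ (N - 2)) 1 volume := by
      refine HasCompactSupport.memLp_of_bound ?_
        ((hmz.norm.pow_const _).mul (hmv.norm.pow_const _)).aestronglyMeasurable
        ((C : ℝ) ^ 2 * (N * conjExp N) ^ (N - 2)) (Eventually.of_forall fun x => ?_)
      · exact (hgc.comp_left (g := fun y => ‖y‖ ^ 2) (by simp)).mul_right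
      · have h1 := bz x
        have h2 := norm_gradient_vN_le hN x
        rw [norm_mul, norm_pow, norm_pow, norm_norm, norm_norm]
        gcongr
    refine (memLp_one_iff_integrable.1 h1).congr ?_
    filter_upwards [hae] with x hx
    rw [hx]

theorem OnofriBound.lipschitz (hN : 2 ≤ N) {m : ℝ} (h : OnofriBound N m)
    {z : EuclideanSpace ℝ (Fin N) → ℝ} {C : NNReal}
    (hz : LipschitzWith C z) (hzc : HasCompactSupport z) :
    ∫⁻ x, ENNReal.ofReal (Real.exp (z x)) ∂(muMeasure N) ≤
      ENNReal.ofReal (Real.exp ((1 / omegaTilde N) * (∫ x, remainder N (∇ (vN N) x) (∇ z x))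
        + ∫ x, z x ∂(muMeasure N) - m)) := by
  obtain ⟨h1, h2⟩ := lipschitz_mem_weightedSobolev hN hz hzc
  refine (h z h1).trans (le_of_eq ?_)
  have : ∫ x, HN N z x = ∫ x, remainder N (∇ (vN N) x) (∇ z x) := by
    refine integral_congr_ae ?_
    filter_upwards [h2] with x hx
    rw [HN, hx]
  rw [this]

theorem isOpen_unitBall (N : ℕ) : IsOpen (unitBall N) := Metric.isOpen_ball

theorem smooth_mem_sobolevW10 {φ : EuclideanSpace ℝ (Fin N) → ℝ} (hφ : ContDiff ℝ ∞ φ)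
    (hc : HasCompactSupport φ) (hs : tsupport φ ⊆ unitBall N) (p : ℝ≥0∞) :
    φ ∈ sobolevW10 p (unitBall N) ∧
      weakGradient (unitBall N) φ =ᵐ[volume.restrict (unitBall N)] ∇ φ := by
  obtain ⟨C, hC⟩ := (hφ.of_le (by simp) : ContDiff ℝ 1 φ).lipschitzWith_of_hasCompactSupport hc
    one_ne_zero
  have hw : HasWeakGradient (unitBall N) φ (∇ φ) := (hasWeakGradient_of_lipschitz hC hc).mono
  have hae := hw.weakGradient_ae_eq (isOpen_unitBall N)
  have hgc : HasCompactSupport (∇ φ) :=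
    (hc.fderiv ℝ).comp_left (map_zero (InnerProductSpace.toDual ℝ _).symm)
  refine ⟨⟨⟨?_, ⟨_, hw⟩, ?_⟩, fun _ => φ, fun _ => ⟨hφ, hc, hs⟩, ?_, ?_⟩, hae⟩
  · exact (hφ.continuous.memLp_of_hasCompactSupport hc).restrict _
  · rw [memLp_congr_ae hae]
    exact ((continuous_gradient (hφ.of_le (by simp))).memLp_of_hasCompactSupport hgc).restrict _
  · simp
  · have : ∇ φ - weakGradient (unitBall N) φ =ᵐ[volume.restrict (unitBall N)] 0 := by
      filter_upwards [hae] with x hx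
      simp [hx]
    simp [eLpNorm_congr_ae this]

theorem CarlesonChangBound.smooth (hN : 2 ≤ N) {m : ℝ} (h : CarlesonChangBound N m)
    {φ : EuclideanSpace ℝ (Fin N) → ℝ} (hφ : ContDiff ℝ ∞ φ)
    (hc : HasCompactSupport φ) (hs : tsupport φ ⊆ unitBall N) :
    ∫⁻ x in unitBall N, ENNReal.ofReal (Real.exp (φ x)) ≤
      ENNReal.ofReal (Real.exp ((1 / omegaTilde N) * (∫ x, ‖∇ φ x‖ ^ N) - m
        + Real.log (ballVolume N))) := by
  obtain ⟨h1, h2⟩ := smooth_mem_sobolevW10 hφ hc hs N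
  refine (h φ h1).trans (le_of_eq ?_)
  have : ∫ x in unitBall N, ‖weakGradient (unitBall N) φ x‖ ^ N = ∫ x, ‖∇ φ x‖ ^ N := by
    rw [← setIntegral_eq_of_tsupport_subset hs]
    · refine integral_congr_ae ?_
      filter_upwards [h2] with x hx
      rw [hx]
    · intro x hx
      rw [gradient_eq_zero_of_notMem_tsupport hx]
      simp; omega
  rw [this]

/-! ### Dilations -/

/-- The factor $c^N$ from the gradient cancels the Jacobian, as the exponent equals the dimension.
-/
theorem integral_norm_gradient_comp_smul (f : EuclideanSpace ℝ (Fin N) → ℝ) {c : ℝ} (hc : 0 < c) :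
    ∫ x, ‖∇ (fun y => f (c • y)) x‖ ^ N = ∫ x, ‖∇ f x‖ ^ N := by
  have e : ∀ x, ‖∇ (fun y => f (c • y)) x‖ ^ N = c ^ N * ‖∇ f (c • x)‖ ^ N := by
    intro x
    rw [norm_gradient_eq, norm_gradient_eq, fderiv_comp_smul, norm_smul, mul_pow,
      Real.norm_of_nonneg hc.le]
  simp_rw [e]
  rw [integral_const_mul, Measure.integral_comp_smul_of_nonneg volume
    (fun x => ‖∇ f x‖ ^ N) c (hR := hc.le), finrank_euclideanSpace_fin, smul_eq_mul, ← mul_assoc,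
    mul_inv_cancel₀ (by positivity), one_mul]

theorem setLIntegral_ball_comp_inv_smul {f : EuclideanSpace ℝ (Fin N) → ℝ≥0∞} (hf : Measurable f)
    {S : ℝ} (hS : 0 < S) :
    ∫⁻ x in Metric.ball 0 S, f (S⁻¹ • x)
      = ENNReal.ofReal (S ^ N) * ∫⁻ x in unitBall N, f x := by
  have h := setLIntegral_map (μ := (volume : Measure (EuclideanSpace ℝ (Fin N))))
    (g := fun x => S⁻¹ • x) (isOpen_unitBall N).measurableSet hf (measurable_const_smul _)
  have e : (fun x : EuclideanSpace ℝ (Fin N) => S⁻¹ • x) ⁻¹' unitBall N = Metric.ball 0 S := by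
    ext x
    simp [unitBall, norm_smul, abs_of_pos hS, inv_mul_lt_iff₀ hS]
  rw [e, Measure.map_addHaar_smul _ (inv_ne_zero hS.ne'), Measure.restrict_smul,
    lintegral_smul_measure] at h
  rw [← h, finrank_euclideanSpace_fin, inv_pow, inv_inv, abs_of_pos (by positivity), smul_eq_mul]

/-! ### From the bound on `ℝᴺ` to the bound on the ball -/

theorem exp_mul_pow_eq {S : ℝ} (hS : 0 < S) (N : ℕ) (a : ℝ) :
    Real.exp a * S ^ N = Real.exp (a + N * Real.log S) := by
  rw [Real.exp_add, ← Real.log_pow, Real.exp_log (by positivity)]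

/-- On the ball $\mu_N=e^{v_N}$ and $v_N$ is $v_N(S)$ plus the cap, so the density is absorbed into
the exponent. -/
theorem setLIntegral_ball_exp_muMeasure (hN : 2 ≤ N) (S : ℝ) (z : EuclideanSpace ℝ (Fin N) → ℝ) :
    ∫⁻ x in Metric.ball 0 S, ENNReal.ofReal (Real.exp (z x)) ∂(muMeasure N)
      = ENNReal.ofReal (Real.exp (vRadial N S)) *
        ∫⁻ x in Metric.ball 0 S, ENNReal.ofReal (Real.exp (addCap z S x)) := by
  rw [muMeasure, restrict_withDensity Metric.isOpen_ball.measurableSet,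
    lintegral_withDensity_eq_lintegral_mul_non_measurable _
      (continuous_muDensity hN).measurable.ennreal_ofReal (by simp),
    ← lintegral_const_mul' _ _ ENNReal.ofReal_ne_top]
  refine setLIntegral_congr_fun Metric.isOpen_ball.measurableSet fun x hx => ?_
  have hx' : ‖x‖ ≤ S := by simpa using (mem_ball_zero_iff.1 hx).le
  simp only [Pi.mul_apply, addCap, cap_eq_of_le hN hx']
  rw [← ENNReal.ofReal_mul (muDensity_pos x).le, ← ENNReal.ofReal_mul (Real.exp_pos _).le,
    ← exp_vN, ← Real.exp_add, ← Real.exp_add]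
  ring_nf

theorem OnofriBound.ball (hN : 2 ≤ N) {m : ℝ} (h : OnofriBound N m)
    {φ : EuclideanSpace ℝ (Fin N) → ℝ} (hφ : ContDiff ℝ ∞ φ)
    (hc : HasCompactSupport φ) (hs : tsupport φ ⊆ unitBall N) {S : ℝ} (hS : 0 < S) :
    ∫⁻ x in unitBall N, ENNReal.ofReal (Real.exp (φ x)) ≤
      ENNReal.ofReal (Real.exp ((1 / omegaTilde N) * (∫ x, ‖∇ φ x‖ ^ N) - m - ballDefect N S
        + Real.log (ballVolume N))) := by
  set ψ : EuclideanSpace ℝ (Fin N) → ℝ := fun x => φ (S⁻¹ • x) with hψ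
  obtain ⟨C, hC⟩ := (hφ.of_le (by simp) : ContDiff ℝ 1 φ).lipschitzWith_of_hasCompactSupport hc
    one_ne_zero
  obtain ⟨D, hD⟩ := lipschitzWith_cap hN S
  -- Subtracting the cap makes adding it back return exactly the dilated `φ`.
  set z : EuclideanSpace ℝ (Fin N) → ℝ := fun x => ψ x - max (vN N x - vRadial N S) 0 with hz
  have hzL : LipschitzWith _ z := (hC.comp (lipschitzWith_smul S⁻¹)).sub hD
  have hz0 : ∀ x, S < ‖x‖ → z x = 0 := by
    intro x hx
    have : φ (S⁻¹ • x) = 0 := by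
      refine image_eq_zero_of_notMem_tsupport fun h => ?_
      have := hs h
      rw [unitBall, mem_ball_zero_iff, norm_smul, Real.norm_of_nonneg (by positivity),
        inv_mul_lt_iff₀ hS] at this
      linarith
    simp only [hz, hψ, this, cap_eq_zero_of_ge hN hS.le hx.le, sub_zero]
  have hcap : addCap z S = ψ := by ext x; simp [addCap, hz]
  have h1 := h.lipschitz hN hzL (hasCompactSupport_of_norm_gt hz0)
  have h2 := integral_norm_gradient_addCap hN hzL hS.le hz0
  rw [hcap, hψ, integral_norm_gradient_comp_smul φ (inv_pos.2 hS)] at h2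
  -- The mass outside the ball is discarded, which is the favourable direction.
  have h3 := (setLIntegral_le_lintegral (Metric.ball 0 S) _).trans h1
  rw [setLIntegral_ball_exp_muMeasure hN, hcap, hψ, setLIntegral_ball_comp_inv_smul
    (f := fun x => ENNReal.ofReal (Real.exp (φ x)))
    (by have := hφ.continuous.measurable; fun_prop) hS, ← mul_assoc,
    ← ENNReal.ofReal_mul (Real.exp_pos _).le, exp_mul_pow_eq hS, mul_comm,
    ← ENNReal.le_div_iff_mul_le (by simp [Real.exp_pos]) (by simp),
    ← ENNReal.ofReal_div_of_pos (Real.exp_pos _), ← Real.exp_sub] at h3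
  refine h3.trans (le_of_eq ?_)
  rw [h2]
  have := (omegaTilde_pos hN).ne'
  congr 2
  simp only [ballDefect]
  field_simp
  ring

/-- Convergence in `L^N` implies convergence of the `N`-energies. -/
theorem tendsto_integral_norm_pow {α F : Type*} [MeasurableSpace α] {μ : Measure α}
    [NormedAddCommGroup F] {n : ℕ} (hn : 1 ≤ n) {f : ℕ → α → F} {g : α → F}
    (hf : ∀ k, MemLp (f k) n μ) (hg : MemLp g n μ)
    (h : Tendsto (fun k => eLpNorm (f k - g) n μ) atTop (𝓝 0)) :
    Tendsto (fun k => ∫ x, ‖f k x‖ ^ n ∂μ) atTop (𝓝 (∫ x, ‖g x‖ ^ n ∂μ)) := by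
  have : Fact ((1 : ℝ≥0∞) ≤ n) := ⟨by exact_mod_cast hn⟩
  have key : ∀ {f : α → F} (hf : MemLp f n μ), ∫ x, ‖f x‖ ^ n ∂μ = ‖hf.toLp f‖ ^ n := by
    intro f hf
    have h0 : 0 ≤ ∫ x, ‖f x‖ ^ n ∂μ := integral_nonneg fun x => by positivity
    rw [Lp.norm_toLp, hf.eLpNorm_eq_integral_rpow_norm (by simp; omega) (by simp)]
    simp only [ENNReal.toReal_natCast, Real.rpow_natCast]
    rw [ENNReal.toReal_ofReal (by positivity), ← Real.rpow_natCast, ← Real.rpow_mul h0,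
      inv_mul_cancel₀ (by positivity), Real.rpow_one]
  simp_rw [key (hf _), key hg]
  exact (((Lp.tendsto_Lp_iff_tendsto_eLpNorm'' f hf g hg).2 h).norm).pow n

theorem OnofriBound.carlesonChangBound (hN : 2 ≤ N) {m : ℝ} (h : OnofriBound N m) :
    CarlesonChangBound N (m - ∑ k ∈ Finset.Icc 1 (N - 1), (1 : ℝ) / k) := by
  set H := ∑ k ∈ Finset.Icc 1 (N - 1), (1 : ℝ) / k
  have smooth : ∀ φ : EuclideanSpace ℝ (Fin N) → ℝ, ContDiff ℝ ∞ φ → HasCompactSupport φ →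
      tsupport φ ⊆ unitBall N → ∫⁻ x in unitBall N, ENNReal.ofReal (Real.exp (φ x)) ≤
      ENNReal.ofReal (Real.exp ((1 / omegaTilde N) * (∫ x, ‖∇ φ x‖ ^ N) - (m - H)
        + Real.log (ballVolume N))) := by
    intro φ hφ hc hs
    have h1 : Tendsto (fun S => ENNReal.ofReal (Real.exp ((1 / omegaTilde N) * (∫ x, ‖∇ φ x‖ ^ N)
        - m - ballDefect N S + Real.log (ballVolume N)))) atTop
        (𝓝 (ENNReal.ofReal (Real.exp ((1 / omegaTilde N) * (∫ x, ‖∇ φ x‖ ^ N)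
        - m - (-H) + Real.log (ballVolume N))))) :=
      ENNReal.tendsto_ofReal ((Real.continuous_exp.tendsto _).comp
        ((tendsto_const_nhds.sub (tendsto_ballDefect hN)).add_const _))
    have h2 := ge_of_tendsto h1 (by
      filter_upwards [eventually_gt_atTop 0] with S hS using h.ball hN hφ hc hs hS)
    refine h2.trans (le_of_eq ?_)
    ring_nf
  rintro u ⟨⟨hu, hug, hgN⟩, φ, hφ, h1, h2⟩
  have hN0 : (N : ℝ≥0∞) ≠ 0 := by simp; omega
  have hm : ∀ k, AEStronglyMeasurable (φ k) (volume.restrict (unitBall N)) := fun k =>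
    (hφ k).1.continuous.aestronglyMeasurable
  -- A subsequence converging almost everywhere suffices for Fatou; the energies converge along the
  -- whole sequence.
  obtain ⟨ns, hns, hae⟩ :=
    (tendstoInMeasure_of_tendsto_eLpNorm hN0 hm hu.1 h1).exists_seq_tendsto_ae
  have hgm : ∀ k, MemLp (∇ (φ k)) N (volume.restrict (unitBall N)) := fun k =>
    ((continuous_gradient ((hφ k).1.of_le (by simp))).memLp_of_hasCompactSupport
      (((hφ k).2.1.fderiv ℝ).comp_left (map_zero (InnerProductSpace.toDual ℝ _).symm))).restrict _
  have hE := (tendsto_integral_norm_pow (by omega) hgm hgN h2).comp hns.tendsto_atTop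
  refine lintegral_exp_le_of_tendsto (fun k => (hm (ns k)).aemeasurable) hae
    (((hE.const_mul (1 / omegaTilde N)).sub_const (m - H)).add_const (Real.log (ballVolume N)))
    (Eventually.of_forall fun k => ?_)
  obtain ⟨a, b, c⟩ := hφ (ns k)
  refine (smooth _ a b c).trans (le_of_eq ?_)
  simp only [Function.comp_apply]
  rw [setIntegral_eq_of_tsupport_subset c]
  intro x hx
  rw [gradient_eq_zero_of_notMem_tsupport hx]
  simp; omega

/-! ### From the bound on the ball to Lipschitz functions on `ℝᴺ` -/

/-- Mollification turns `w` into test functions without raising the energy, by Jensen. The strict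
inequality `r < 1` leaves room for the supports to stay inside the ball. -/
theorem CarlesonChangBound.lipschitz_unitBall (hN : 2 ≤ N) {m : ℝ} (h : CarlesonChangBound N m)
    {w : EuclideanSpace ℝ (Fin N) → ℝ} {C : NNReal} (hw : LipschitzWith C w) {r : ℝ} (hr : r < 1)
    (hw0 : ∀ x, r < ‖x‖ → w x = 0) :
    ∫⁻ x in unitBall N, ENNReal.ofReal (Real.exp (w x)) ≤
      ENNReal.ofReal (Real.exp ((1 / omegaTilde N) * (∫ x, ‖∇ w x‖ ^ N) - m
        + Real.log (ballVolume N))) := by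
  have hloc := hw.continuous.locallyIntegrable (μ := volume)
  have hwg := hasWeakGradient_of_lipschitz hw (hasCompactSupport_of_norm_gt hw0)
  have hgl := locallyIntegrableOn_univ.1 hwg.2.1
  have hgi : Integrable (fun x => ‖∇ w x‖ ^ N) volume := by
    refine integrable_of_bounded_of_norm_gt (S := r) (C := (C : ℝ) ^ N)
      ((measurable_gradient w).norm.pow_const _).aestronglyMeasurable (fun x => ?_) fun x hx => ?_
    · rw [norm_pow, norm_norm]
      exact pow_le_pow_left₀ (norm_nonneg _) (norm_gradient_le_of_lipschitz hw x) _
    · rw [gradient_of_eventuallyEq_const (eq_zero_nhds_of_norm_gt hw0 hx)]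
      simp; omega
  have hsm := contDiff_mollify hloc
  refine lintegral_exp_le_of_tendsto (X := fun n => mollify w n)
    (fun n => (hsm n).continuous.measurable.aemeasurable)
    (ae_restrict_of_ae (ae_tendsto_mollify hloc)) tendsto_const_nhds ?_
  filter_upwards [(tendsto_mollifierBump_rOut N).eventually_lt_const (sub_pos.2 hr)] with n hn
  have h0 := mollify_eq_zero_of_norm_gt hw0 n
  have hsupp : tsupport (mollify w n) ⊆ unitBall N := by
    refine (closure_minimal (t := Metric.closedBall 0 (r + (mollifierBump N n).rOut)) ?_
      Metric.isClosed_closedBall).trans (Metric.closedBall_subset_ball (by linarith))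
    intro x hx
    by_contra hx'
    exact hx (h0 x (by simpa using hx'))
  refine (h.smooth hN (hsm n) (hasCompactSupport_of_norm_gt h0) hsupp).trans ?_
  refine ENNReal.ofReal_le_ofReal (Real.exp_le_exp.2 ?_)
  have hω := omegaTilde_pos hN
  have key : ∫ x, ‖∇ (mollify w n) x‖ ^ N ≤ ∫ x, ‖∇ w x‖ ^ N := by
    rw [← integral_mollify hgi n]
    refine integral_mono_of_nonneg (Eventually.of_forall fun x => by positivity)
      (integrable_mollify hgi n) (Eventually.of_forall fun x => ?_)
    simp only [hwg.gradient_mollify]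
    exact norm_mollify_pow_le hgl hN hgi.locallyIntegrable n x
  gcongr

theorem CarlesonChangBound.lipschitz_ball (hN : 2 ≤ N) {m : ℝ} (h : CarlesonChangBound N m)
    {w : EuclideanSpace ℝ (Fin N) → ℝ} {C : NNReal} (hw : LipschitzWith C w) {S T : ℝ} (hT : 0 < T)
    (hST : S < T) (hw0 : ∀ x, S < ‖x‖ → w x = 0) :
    ∫⁻ x in Metric.ball 0 T, ENNReal.ofReal (Real.exp (w x)) ≤
      ENNReal.ofReal (Real.exp ((1 / omegaTilde N) * (∫ x, ‖∇ w x‖ ^ N) - m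
        + Real.log (ballVolume N) + N * Real.log T)) := by
  have h1 := h.lipschitz_unitBall hN (w := fun x => w (T • x)) (r := S / T)
    (hw.comp (lipschitzWith_smul T)) ((div_lt_one hT).2 hST) fun x hx => hw0 _ (by
      rw [norm_smul, Real.norm_of_nonneg hT.le]
      rwa [div_lt_iff₀' hT] at hx)
  have h2 := setLIntegral_ball_comp_inv_smul
    (f := fun x : EuclideanSpace ℝ (Fin N) => ENNReal.ofReal (Real.exp (w (T • x))))
    (by have := hw.continuous.measurable; fun_prop) hT
  simp only [smul_smul, mul_inv_cancel₀ hT.ne', one_smul] at h2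
  rw [h2, ← exp_mul_pow_eq hT, mul_comm, ENNReal.ofReal_mul (Real.exp_pos _).le]
  rw [integral_norm_gradient_comp_smul w hT] at h1
  gcongr

theorem CarlesonChangBound.lipschitz (hN : 2 ≤ N) {m : ℝ}
    (h : CarlesonChangBound N (m - ∑ k ∈ Finset.Icc 1 (N - 1), (1 : ℝ) / k))
    {z : EuclideanSpace ℝ (Fin N) → ℝ} {C : NNReal} (hz : LipschitzWith C z)
    (hzc : HasCompactSupport z) :
    ∫⁻ x, ENNReal.ofReal (Real.exp (z x)) ∂(muMeasure N) ≤
      ENNReal.ofReal (Real.exp ((1 / omegaTilde N) * (∫ x, remainder N (∇ (vN N) x) (∇ z x))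
        + ∫ x, z x ∂(muMeasure N) - m)) := by
  set H := ∑ k ∈ Finset.Icc 1 (N - 1), (1 : ℝ) / k
  set P := (1 / omegaTilde N) * (∫ x, remainder N (∇ (vN N) x) (∇ z x))
        + ∫ x, z x ∂(muMeasure N) with hP
  obtain ⟨S₀, hS₀⟩ := hzc.isCompact.isBounded.subset_closedBall 0
  have hz0 : ∀ x, S₀ < ‖x‖ → z x = 0 := fun x hx =>
    image_eq_zero_of_notMem_tsupport fun h => by
      have := mem_closedBall_zero_iff.1 (hS₀ h); linarith
  have step : ∀ S, 0 < S → S₀ ≤ S →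
      ∫⁻ x in Metric.ball 0 S, ENNReal.ofReal (Real.exp (z x)) ∂(muMeasure N) ≤
        ENNReal.ofReal (Real.exp (P + ballDefect N S - (m - H)
          + N * Real.log ((S + 1) / S))) := by
    intro S hS hSS
    have hzS : ∀ x, S < ‖x‖ → z x = 0 := fun x hx => hz0 x (by linarith)
    obtain ⟨D, hD⟩ := lipschitzWith_cap hN S
    have hwL : LipschitzWith _ (addCap z S) := hz.add hD
    -- The radius `S + 1` instead of `S` gives the mollification room; it costs $N\ln\frac{S+1}{S}$,
    -- which vanishes in the limit.
    have h1 := h.lipschitz_ball hN hwL (by linarith : 0 < S + 1) (by linarith : S < S + 1)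
      (addCap_eq_zero hN hS.le hzS)
    have h2 := integral_norm_gradient_addCap hN hz hS.le hzS
    rw [setLIntegral_ball_exp_muMeasure hN]
    refine (mul_le_mul_right ((lintegral_mono_set (Metric.ball_subset_ball (by linarith))).trans h1)
      _).trans (le_of_eq ?_)
    rw [← ENNReal.ofReal_mul (Real.exp_pos _).le, ← Real.exp_add, h2]
    have := (omegaTilde_pos hN).ne'
    congr 2
    rw [Real.log_div (by positivity) hS.ne']
    simp only [ballDefect, hP]
    field_simp
    ring
  have hlog : Tendsto (fun S : ℝ => Real.log ((S + 1) / S)) atTop (𝓝 0) := by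
    have h1 : Tendsto (fun S : ℝ => 1 + S⁻¹) atTop (𝓝 (1 + 0)) :=
      tendsto_const_nhds.add tendsto_inv_atTop_zero
    rw [add_zero] at h1
    have h2 := (Real.continuousAt_log one_ne_zero).tendsto.comp h1
    rw [Real.log_one] at h2
    refine h2.congr' ?_
    filter_upwards [eventually_gt_atTop 0] with S hS
    rw [Function.comp_apply, add_div, div_self hS.ne', one_div]
  have hlim : Tendsto (fun S => ENNReal.ofReal (Real.exp (P + ballDefect N S - (m - H)
      + N * Real.log ((S + 1) / S)))) atTop
      (𝓝 (ENNReal.ofReal (Real.exp (P + (-H) - (m - H) + N * 0)))) :=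
    ENNReal.tendsto_ofReal ((Real.continuous_exp.tendsto _).comp
      (((tendsto_const_nhds.add (tendsto_ballDefect hN)).sub_const _).add (hlog.const_mul _)))
  have e : P + (-H) - (m - H) + N * 0 = P - m := by ring
  rw [e] at hlim
  -- The domain is frozen at radius `n` while `S → ∞`; the balls of integer radius then exhaust the
  -- space.
  have hball : ∀ n : ℕ, ∫⁻ x in Metric.ball 0 (n : ℝ), ENNReal.ofReal (Real.exp (z x))
      ∂(muMeasure N) ≤ ENNReal.ofReal (Real.exp (P - m)) := by
    intro n
    refine ge_of_tendsto hlim ?_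
    filter_upwards [eventually_gt_atTop 0, eventually_ge_atTop S₀, eventually_ge_atTop (n : ℝ)]
      with S h1 h2 h3
    exact (lintegral_mono_set (Metric.ball_subset_ball h3)).trans (step S h1 h2)
  rw [← setLIntegral_univ, ← Metric.iUnion_ball_nat 0, setLIntegral_iUnion_of_directed]
  · exact iSup_le hball
  · exact Monotone.directed_le fun a b hab => Metric.ball_subset_ball (by exact_mod_cast hab)

/-! ### Cutoff functions of small energy -/

theorem exists_bound_deriv_smoothTransition :
    ∃ K : ℝ, 0 ≤ K ∧ ∀ t, |deriv Real.smoothTransition t| ≤ K := by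
  have hc : Continuous (deriv Real.smoothTransition) :=
    (Real.smoothTransition.contDiff (n := 1)).continuous_deriv le_rfl
  have hs : HasCompactSupport (deriv Real.smoothTransition) := by
    refine HasCompactSupport.intro (isCompact_Icc (a := (0 : ℝ)) (b := 1)) fun t ht => ?_
    rcases lt_or_ge t 0 with h | h
    · have : Real.smoothTransition =ᶠ[𝓝 t] fun _ => 0 := by
        filter_upwards [gt_mem_nhds h] with s hs
        exact Real.smoothTransition.zero_of_nonpos hs.le
      rw [this.deriv_eq, deriv_const]
    · have h1 : 1 < t := by by_contra h'; exact ht ⟨h, not_lt.1 h'⟩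
      have : Real.smoothTransition =ᶠ[𝓝 t] fun _ => 1 := by
        filter_upwards [lt_mem_nhds h1] with s hs
        exact Real.smoothTransition.one_of_one_le hs.le
      rw [this.deriv_eq, deriv_const]
  obtain ⟨K, hK⟩ := hc.bounded_above_of_compact_support hs
  exact ⟨K, (norm_nonneg _).trans (hK 0), hK⟩

theorem ballEnergy_le (N : ℕ) {S : ℝ} (hS : 0 ≤ S) :
    ballEnergy N S ≤ Real.log (1 + S ^ conjExp N) := by
  have := Real.rpow_nonneg hS (conjExp N)
  have : 0 ≤ ∑ k ∈ Finset.Icc 1 (N - 1), (S ^ conjExp N / (1 + S ^ conjExp N)) ^ k / (k : ℝ) :=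
    Finset.sum_nonneg fun k _ => by positivity
  rw [ballEnergy, energyPrimitive]; linarith

/-- The `N`-capacity of infinity vanishes: there are cutoff functions of small energy. -/
theorem exists_cutoff (hN : 2 ≤ N) {ε : ℝ} (hε : 0 < ε) (R : ℝ) :
    ∃ η : EuclideanSpace ℝ (Fin N) → ℝ, ContDiff ℝ 1 η ∧ HasCompactSupport η ∧
      (∀ x, 0 ≤ η x ∧ η x ≤ 1) ∧ (∀ x, ‖x‖ < R → η x = 1) ∧
      Integrable (fun x => ‖∇ (vN N) x‖ ^ (N - 2) * ‖∇ η x‖ ^ 2 + ‖∇ η x‖ ^ N) volume ∧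
      ∫ x, (‖∇ (vN N) x‖ ^ (N - 2) * ‖∇ η x‖ ^ 2 + ‖∇ η x‖ ^ N) ≤ ε := by
  obtain ⟨K, hK0, hK⟩ := exists_bound_deriv_smoothTransition
  have hω := omegaTilde_pos hN
  have hNr := two_le_cast hN
  have hq := conjExp_pos hN
  -- The energy of the cutoff will be at most `B / L`.
  set B := (K ^ 2 + K ^ N) * (2 * omegaTilde N / N) with hB
  have hB0 : 0 ≤ B := by positivity
  -- The scale `L` is at least 1 to compare powers of `L`, large enough that the cutoff equals one
  -- on $B_R$, and large enough that `B / L ≤ ε`.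
  set L := max (max 1 (N * Real.log (1 + R ^ conjExp N))) (B / ε) with hL
  have hL1 : 1 ≤ L := (le_max_left _ _).trans (le_max_left _ _)
  have hL2 : N * Real.log (1 + R ^ conjExp N) ≤ L := (le_max_right _ _).trans (le_max_left _ _)
  have hL3 : B / L ≤ ε := by
    rw [div_le_iff₀ (by linarith), mul_comm, ← div_le_iff₀ hε]; exact le_max_right _ _
  have hL0 : 0 < L := by linarith
  -- The radius at which $N\ln(1+S^q)=2L$, where the argument of the transition reaches zero.
  set S := (Real.exp (2 * L / N) - 1) ^ (conjExp N)⁻¹ with hS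
  have hexp : 0 ≤ Real.exp (2 * L / N) - 1 := by
    have := Real.one_le_exp (by positivity : 0 ≤ 2 * L / N); linarith
  have hS0 : 0 ≤ S := Real.rpow_nonneg hexp _
  have hSq : 1 + S ^ conjExp N = Real.exp (2 * L / N) := by
    rw [hS, Real.rpow_inv_rpow hexp hq.ne']; ring
  -- A logarithmic profile built from $v_N$: at least 1 where $N\ln(1+|x|^q)\le L$ and at most 0
  -- where it exceeds $2L$. Hence $|\nabla\eta|\le(K/L)|\nabla v_N|$, and the energy is of order
  -- $L^{-2}\cdot L$.
  set f : EuclideanSpace ℝ (Fin N) → ℝ :=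
    fun x => 2 + L⁻¹ * (vN N x + Real.log (ballVolume N)) with hf
  have hfv : ∀ x, f x = 2 - N * Real.log (1 + ‖x‖ ^ conjExp N) / L := by
    intro x; simp only [hf, vN_eq]; ring
  have hfd : ContDiff ℝ 1 f :=
    contDiff_const.add (contDiff_const.mul ((contDiff_vN hN).add contDiff_const))
  set η : EuclideanSpace ℝ (Fin N) → ℝ := fun x => Real.smoothTransition (f x) with hη
  have hηd : ContDiff ℝ 1 η := Real.smoothTransition.contDiff.comp hfd
  have hη0 : ∀ x, S < ‖x‖ → η x = 0 := by
    intro x hx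
    refine Real.smoothTransition.zero_of_nonpos ?_
    have h1 : S ^ conjExp N ≤ ‖x‖ ^ conjExp N := Real.rpow_le_rpow hS0 hx.le hq.le
    have h2 : 2 * L / N ≤ Real.log (1 + ‖x‖ ^ conjExp N) := by
      rw [Real.le_log_iff_exp_le (by positivity), ← hSq]; linarith
    rw [hfv, sub_nonpos, le_div_iff₀ hL0]
    rwa [div_le_iff₀' (by linarith)] at h2
  have hηc : HasCompactSupport η := hasCompactSupport_of_norm_gt hη0
  have hgrad : ∀ x, ‖∇ η x‖ ≤ K / L * ‖∇ (vN N) x‖ := by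
    intro x
    have hv := ((contDiff_vN hN).differentiable one_ne_zero x).hasFDerivAt
    have h1 := ((hv.add_const (Real.log (ballVolume N))).const_mul L⁻¹).const_add 2
    have h2 := (Real.smoothTransition.contDiff (n := 1)).differentiable one_ne_zero (f x)
    have h3 : HasFDerivAt η _ x := h2.hasDerivAt.comp_hasFDerivAt x h1
    rw [norm_gradient_eq, norm_gradient_eq, h3.fderiv, norm_smul, norm_smul,
      Real.norm_of_nonneg (inv_nonneg.2 hL0.le), ← mul_assoc, div_eq_mul_inv]
    have := hK (f x)
    rw [← Real.norm_eq_abs] at this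
    gcongr
  have hgrad0 : ∀ x, S < ‖x‖ → ∇ η x = 0 := fun x hx =>
    gradient_of_eventuallyEq_const (eq_zero_nhds_of_norm_gt hη0 hx)
  have hdom : Integrable ((Metric.ball (0 : EuclideanSpace ℝ (Fin N)) S).indicator
      fun x => ‖∇ (vN N) x‖ ^ N) volume := by
    rw [integrable_indicator_iff Metric.isOpen_ball.measurableSet]
    exact (((continuous_gradient (contDiff_vN hN)).norm.pow N).continuousOn.integrableOn_compact
      (isCompact_closedBall 0 S)).mono_set Metric.ball_subset_closedBall
  have hpt : ∀ᵐ x : EuclideanSpace ℝ (Fin N),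
      ‖∇ (vN N) x‖ ^ (N - 2) * ‖∇ η x‖ ^ 2 + ‖∇ η x‖ ^ N
      ≤ ((K ^ 2 + K ^ N) / L ^ 2) * (Metric.ball (0 : EuclideanSpace ℝ (Fin N)) S).indicator
        (fun x => ‖∇ (vN N) x‖ ^ N) x := by
    filter_upwards [ae_norm_ne (by omega : N ≠ 0) S] with x hx
    rcases lt_or_gt_of_ne hx with h | h
    · rw [Set.indicator_of_mem (by simpa using h)]
      have h1 := hgrad x
      have h2 : ‖∇ (vN N) x‖ ^ (N - 2) * ‖∇ (vN N) x‖ ^ 2 = ‖∇ (vN N) x‖ ^ N := by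
        rw [← pow_add]; congr 1; omega
      have h3 : (K / L) ^ N ≤ K ^ N / L ^ 2 := by
        rw [div_pow]
        exact div_le_div_of_nonneg_left (by positivity) (by positivity)
          (pow_le_pow_right₀ hL1 hN)
      calc _ ≤ ‖∇ (vN N) x‖ ^ (N - 2) * (K / L * ‖∇ (vN N) x‖) ^ 2
            + (K / L * ‖∇ (vN N) x‖) ^ N := by gcongr
        _ = (K / L) ^ 2 * (‖∇ (vN N) x‖ ^ (N - 2) * ‖∇ (vN N) x‖ ^ 2)
            + (K / L) ^ N * ‖∇ (vN N) x‖ ^ N := by rw [mul_pow, mul_pow]; ring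
        _ ≤ (K / L) ^ 2 * ‖∇ (vN N) x‖ ^ N + K ^ N / L ^ 2 * ‖∇ (vN N) x‖ ^ N := by
            rw [h2]; gcongr
        _ = _ := by rw [div_pow]; ring
    · rw [hgrad0 x h, Set.indicator_of_notMem (by simpa using h.le)]
      simp [show N ≠ 0 by omega]
  have hint : Integrable (fun x => ‖∇ (vN N) x‖ ^ (N - 2) * ‖∇ η x‖ ^ 2 + ‖∇ η x‖ ^ N) volume := by
    refine (hdom.const_mul ((K ^ 2 + K ^ N) / L ^ 2)).mono' ?_ ?_
    · have h1 := continuous_gradient hηd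
      have h2 := continuous_gradient (contDiff_vN hN)
      exact (((h2.norm.pow _).mul (h1.norm.pow _)).add (h1.norm.pow _)).aestronglyMeasurable
    · filter_upwards [hpt] with x hx
      rwa [Real.norm_of_nonneg (by positivity)]
  refine ⟨η, hηd, hηc, fun x => ⟨Real.smoothTransition.nonneg _, Real.smoothTransition.le_one _⟩,
    fun x hx => ?_, hint, ?_⟩
  · refine Real.smoothTransition.one_of_one_le ?_
    have h1 : ‖x‖ ^ conjExp N ≤ R ^ conjExp N := Real.rpow_le_rpow (norm_nonneg _) hx.le hq.le
    have h2 : Real.log (1 + ‖x‖ ^ conjExp N) ≤ Real.log (1 + R ^ conjExp N) :=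
      Real.log_le_log (by positivity) (by linarith)
    have h3 : N * Real.log (1 + ‖x‖ ^ conjExp N) / L ≤ 1 := by
      rw [div_le_one hL0]
      exact (mul_le_mul_of_nonneg_left h2 (by positivity)).trans hL2
    rw [hfv]; linarith
  · refine (integral_mono_ae hint (hdom.const_mul _) hpt).trans ?_
    rw [integral_const_mul, integral_indicator Metric.isOpen_ball.measurableSet,
      integral_ball_norm_gradient_vN_pow hN hS0]
    have h1 : ballEnergy N S ≤ 2 * L / N := by
      have := ballEnergy_le N hS0
      rwa [hSq, Real.log_exp] at this
    calc _ ≤ (K ^ 2 + K ^ N) / L ^ 2 * (omegaTilde N * (2 * L / N)) := by gcongr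
      _ = B / L := by rw [hB]; field_simp
      _ ≤ ε := hL3

/-! ### A smooth truncation -/

/-- The smooth bounded function `t / (1 + (t / K)²)`. -/
def softTrunc (K t : ℝ) : ℝ := t / (1 + (t / K) ^ 2)

/-- The derivative of `softTrunc K`. -/
def softTruncDeriv (K t : ℝ) : ℝ := (1 - (t / K) ^ 2) / (1 + (t / K) ^ 2) ^ 2

/-- The truncation is not monotone, but only four properties matter: it is bounded by `K` and by
`|t|`, its derivative is bounded by 1, and it tends to the identity. Smoothness lets the classical
chain rule apply to mollifications, so no chain rule for weak gradients is required. -/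
theorem contDiff_softTrunc (K : ℝ) : ContDiff ℝ ∞ (softTrunc K) :=
  contDiff_id.div (contDiff_const.add ((contDiff_id.div_const K).pow 2))
    fun t => by positivity

theorem hasDerivAt_softTrunc (K t : ℝ) : HasDerivAt (softTrunc K) (softTruncDeriv K t) t := by
  have h1 : HasDerivAt (fun t : ℝ => 1 + (t / K) ^ 2) (2 * (t / K) * (1 / K)) t := by
    simpa using (((hasDerivAt_id t).div_const K).pow 2).const_add 1
  have hp : (1 + (t / K) ^ 2) ≠ 0 := by positivity
  refine ((hasDerivAt_id t).div h1 hp).congr_deriv ?_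
  rw [softTruncDeriv]
  congr 1
  simp only [id]
  ring

theorem continuous_softTruncDeriv (K : ℝ) : Continuous (softTruncDeriv K) :=
  (continuous_const.sub ((continuous_id.div_const K).pow 2)).div
    ((continuous_const.add ((continuous_id.div_const K).pow 2)).pow 2)
    fun t => by positivity

theorem abs_softTrunc_le_abs (K t : ℝ) : |softTrunc K t| ≤ |t| := by
  have h : 0 ≤ (t / K) ^ 2 := sq_nonneg _
  rw [softTrunc, abs_div, abs_of_pos (by positivity : 0 < 1 + (t / K) ^ 2)]
  exact div_le_self (abs_nonneg _) (by linarith)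

theorem abs_softTrunc_le {K : ℝ} (hK : 0 < K) (t : ℝ) : |softTrunc K t| ≤ K := by
  rw [softTrunc, abs_div, abs_of_pos (by positivity : 0 < 1 + (t / K) ^ 2),
    div_le_iff₀ (by positivity)]
  have h1 : |t| = |t / K| * K := by rw [abs_div, abs_of_pos hK]; field_simp
  rw [h1, mul_comm]
  refine mul_le_mul_of_nonneg_left ?_ hK.le
  nlinarith [sq_abs (t / K), sq_nonneg (|t / K| - 1)]

theorem abs_softTruncDeriv_le (K t : ℝ) : |softTruncDeriv K t| ≤ 1 := by
  have h : 0 ≤ (t / K) ^ 2 := sq_nonneg _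
  rw [softTruncDeriv, abs_div, abs_of_pos (by positivity : 0 < (1 + (t / K) ^ 2) ^ 2),
    div_le_one (by positivity), abs_le]
  constructor <;> nlinarith

theorem tendsto_softTrunc (t : ℝ) :
    Tendsto (fun k : ℕ => softTrunc ((k : ℝ) + 1) t) atTop (𝓝 t) := by
  have h0 : Tendsto (fun k : ℕ => t / ((k : ℝ) + 1)) atTop (𝓝 0) := by
    simpa [div_eq_mul_inv] using tendsto_one_div_add_atTop_nhds_zero_nat.const_mul t
  have h1 := (tendsto_const_nhds (x := t)).div ((h0.pow 2).const_add 1) (by norm_num)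
  simpa [softTrunc, Pi.div_def] using h1

theorem tendsto_softTruncDeriv (t : ℝ) :
    Tendsto (fun k : ℕ => softTruncDeriv ((k : ℝ) + 1) t) atTop (𝓝 1) := by
  have h0 : Tendsto (fun k : ℕ => t / ((k : ℝ) + 1)) atTop (𝓝 0) := by
    simpa [div_eq_mul_inv] using tendsto_one_div_add_atTop_nhds_zero_nat.const_mul t
  have h1 := ((h0.pow 2).const_sub 1).div (((h0.pow 2).const_add 1).pow 2) (by norm_num)
  simpa [softTruncDeriv, Pi.div_def] using h1

/-- The formal gradient of `η · softTrunc K u` when `u` has gradient `g`. -/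
def truncGradient (K : ℝ) (η u : EuclideanSpace ℝ (Fin N) → ℝ)
    (g : EuclideanSpace ℝ (Fin N) → EuclideanSpace ℝ (Fin N)) (x : EuclideanSpace ℝ (Fin N)) :
    EuclideanSpace ℝ (Fin N) :=
  (η x * softTruncDeriv K (u x)) • g x + softTrunc K (u x) • ∇ η x

theorem gradient_mul_softTrunc {η u : EuclideanSpace ℝ (Fin N) → ℝ} (K : ℝ)
    (hη : ContDiff ℝ 1 η) (hu : ContDiff ℝ 1 u) (x : EuclideanSpace ℝ (Fin N)) :
    ∇ (fun y => η y * softTrunc K (u y)) x = truncGradient K η u (∇ u) x := by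
  have h1 := (hη.differentiable one_ne_zero x).hasFDerivAt
  have h2 := (hasDerivAt_softTrunc K (u x)).comp_hasFDerivAt x
    (hu.differentiable one_ne_zero x).hasFDerivAt
  have h3 : fderiv ℝ (fun y => η y * softTrunc K (u y)) x = _ := (h1.mul h2).fderiv
  refine ext_inner_right ℝ fun y => ?_
  rw [inner_gradient_left, h3, truncGradient, inner_add_left, real_inner_smul_left,
    real_inner_smul_left, inner_gradient_left, inner_gradient_left]
  simp
  ring

/-- Boundedness of the truncation keeps the term with $\nabla\eta$ independent of `u`; the price `K`
is paid by the smallness of the cutoff energy. -/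
theorem norm_truncGradient_le {η u : EuclideanSpace ℝ (Fin N) → ℝ}
    {g : EuclideanSpace ℝ (Fin N) → EuclideanSpace ℝ (Fin N)} {K : ℝ} (hK : 0 < K)
    (hη : ∀ x, 0 ≤ η x ∧ η x ≤ 1) (x : EuclideanSpace ℝ (Fin N)) :
    ‖truncGradient K η u g x‖ ≤ ‖g x‖ + K * ‖∇ η x‖ := by
  refine (norm_add_le _ _).trans (add_le_add ?_ ?_)
  · rw [norm_smul, norm_mul, Real.norm_of_nonneg (hη x).1]
    have h1 := abs_softTruncDeriv_le K (u x)
    have h2 : η x * ‖softTruncDeriv K (u x)‖ ≤ 1 * 1 :=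
      mul_le_mul (hη x).2 h1 (norm_nonneg _) zero_le_one
    calc _ ≤ 1 * 1 * ‖g x‖ := by gcongr
      _ = _ := by ring
  · rw [norm_smul]
    have := abs_softTrunc_le hK (u x)
    rw [← Real.norm_eq_abs] at this
    gcongr

theorem add_pow_le_two_pow {a b : ℝ} (ha : 0 ≤ a) (hb : 0 ≤ b) (n : ℕ) :
    (a + b) ^ n ≤ 2 ^ n * (a ^ n + b ^ n) := by
  rcases le_total a b with h | h
  · calc (a + b) ^ n ≤ (2 * b) ^ n := pow_le_pow_left₀ (by positivity) (by linarith) _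
      _ = 2 ^ n * b ^ n := mul_pow _ _ _
      _ ≤ _ := by gcongr; linarith [pow_nonneg ha n]
  · calc (a + b) ^ n ≤ (2 * a) ^ n := pow_le_pow_left₀ (by positivity) (by linarith) _
      _ = 2 ^ n * a ^ n := mul_pow _ _ _
      _ ≤ _ := by gcongr; linarith [pow_nonneg hb n]

theorem ae_muMeasure_of_ae {p : EuclideanSpace ℝ (Fin N) → Prop} (h : ∀ᵐ x, p x) :
    ∀ᵐ x ∂(muMeasure N), p x :=
  (withDensity_absolutelyContinuous _ _).ae_le h

/-! ### From Lipschitz functions to the whole of `W_{μ_N}` -/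

theorem tendsto_remainder {X y : EuclideanSpace ℝ (Fin N)} {Y : ℕ → EuclideanSpace ℝ (Fin N)}
    (h : Tendsto Y atTop (𝓝 y)) :
    Tendsto (fun n => remainder N X (Y n)) atTop (𝓝 (remainder N X y)) := by
  have hc : Continuous fun Y : EuclideanSpace ℝ (Fin N) => remainder N X Y := by
    unfold remainder; fun_prop
  exact (hc.tendsto y).comp h

theorem aestronglyMeasurable_remainder
    {Y : EuclideanSpace ℝ (Fin N) → EuclideanSpace ℝ (Fin N)}
    (hY : AEStronglyMeasurable Y volume) :
    AEStronglyMeasurable (fun x => remainder N (∇ (vN N) x) (Y x)) volume := by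
  have hX : AEStronglyMeasurable (∇ (vN N)) (volume : Measure (EuclideanSpace ℝ (Fin N))) :=
    (measurable_gradient (vN N)).aestronglyMeasurable
  unfold remainder
  exact (((hX.add hY).norm.pow N).sub (hX.norm.pow N)).sub
    (((hX.norm.pow (N - 2)).const_mul (N : ℝ)).mul (hX.inner hY))

theorem aestronglyMeasurable_truncGradient {η u : EuclideanSpace ℝ (Fin N) → ℝ}
    {g : EuclideanSpace ℝ (Fin N) → EuclideanSpace ℝ (Fin N)} (K : ℝ) (hη : ContDiff ℝ 1 η)
    (hu : AEStronglyMeasurable u volume) (hg : AEStronglyMeasurable g volume) :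
    AEStronglyMeasurable (truncGradient K η u g) volume := by
  have h1 := (continuous_softTruncDeriv K).comp_aestronglyMeasurable hu
  have h2 := (contDiff_softTrunc K).continuous.comp_aestronglyMeasurable hu
  have h3 := hη.continuous.aestronglyMeasurable (μ := volume)
  have h4 := (continuous_gradient hη).aestronglyMeasurable (μ := volume)
  exact ((h3.mul h1).smul hg).add (h2.smul h4)

/-- The inequality for a compactly supported smooth truncation of a weakly differentiable
function. -/
theorem CarlesonChangBound.truncation (hN : 2 ≤ N) {m : ℝ}
    (h : CarlesonChangBound N (m - ∑ k ∈ Finset.Icc 1 (N - 1), (1 : ℝ) / k))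
    {u : EuclideanSpace ℝ (Fin N) → ℝ} {g : EuclideanSpace ℝ (Fin N) → EuclideanSpace ℝ (Fin N)}
    (hug : HasWeakGradient Set.univ u g) (hgN : MemLp g N volume)
    {η : EuclideanSpace ℝ (Fin N) → ℝ} (hη : ContDiff ℝ 1 η) (hηc : HasCompactSupport η)
    (hη1 : ∀ x, 0 ≤ η x ∧ η x ≤ 1) {K : ℝ} (hK : 0 < K) :
    ∫⁻ x, ENNReal.ofReal (Real.exp (η x * softTrunc K (u x))) ∂(muMeasure N) ≤
      ENNReal.ofReal (Real.exp ((1 / omegaTilde N) *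
        (∫ x, remainder N (∇ (vN N) x) (truncGradient K η u g x))
        + ∫ x, η x * softTrunc K (u x) ∂(muMeasure N) - m)) := by
  have hu := locallyIntegrableOn_univ.1 hug.1
  have hg := locallyIntegrableOn_univ.1 hug.2.1
  have hgi : Integrable (fun x => ‖g x‖ ^ N) volume := hgN.integrable_norm_pow (by omega)
  have hun : ∀ n, ContDiff ℝ 1 (mollify u n) := fun n => (contDiff_mollify hu n).of_le (by simp)
  have hud := ae_tendsto_mollify hu
  have hgd := ae_tendsto_mollify hg
  have hsc := (contDiff_softTrunc K).continuous
  -- Mollifying `u` before truncating yields $C^1$ functions of compact support. The formal gradient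
  -- `truncGradient` enters only as the almost everywhere limit of their gradients.
  set z : ℕ → EuclideanSpace ℝ (Fin N) → ℝ := fun n x => η x * softTrunc K (mollify u n x) with hz
  have hzd : ∀ n, ContDiff ℝ 1 (z n) := fun n =>
    hη.mul (((contDiff_softTrunc K).of_le (by simp)).comp (hun n))
  have hzc : ∀ n, HasCompactSupport (z n) := fun n => hηc.mul_right
  have hzg : ∀ n x, ∇ (z n) x = truncGradient K η (mollify u n) (mollify g n) x := by
    intro n x
    rw [hz, gradient_mul_softTrunc K hη (hun n), truncGradient, truncGradient,
      hug.gradient_mollify]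
  obtain ⟨S, hS⟩ := hηc.isCompact.isBounded.subset_closedBall 0
  have hη0 : ∀ x, S < ‖x‖ → η x = 0 := fun x hx =>
    image_eq_zero_of_notMem_tsupport fun h => by
      have := mem_closedBall_zero_iff.1 (hS h); linarith
  have hηg0 : ∀ x, S < ‖x‖ → ∇ η x = 0 := fun x hx =>
    gradient_of_eventuallyEq_const (eq_zero_nhds_of_norm_gt hη0 hx)
  obtain ⟨D, hD⟩ := (continuous_gradient hη).bounded_above_of_compact_support
    ((hηc.fderiv ℝ).comp_left (map_zero (InnerProductSpace.toDual ℝ _).symm))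
  have hD0 : 0 ≤ D := (norm_nonneg _).trans (hD 0)
  obtain ⟨C, hC0, hC⟩ := abs_remainder_le hN
  have hA0 : 0 ≤ N * conjExp N := by have := conjExp_pos hN; positivity
  set A := N * conjExp N with hA
  set b : EuclideanSpace ℝ (Fin N) → ℝ := (Metric.closedBall 0 S).indicator
    fun _ => C * (A ^ N + 2 * (2 ^ N * (K * D) ^ N)) with hb
  have hbi : Integrable b volume :=
    (integrable_indicator_iff Metric.isClosed_closedBall.measurableSet).2
      (integrableOn_const (isCompact_closedBall _ _).measure_lt_top.ne)
  have hR : Tendsto (fun n => ∫ x, remainder N (∇ (vN N) x) (∇ (z n) x)) atTop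
      (𝓝 (∫ x, remainder N (∇ (vN N) x) (truncGradient K η u g x))) := by
    -- The majorants contain the mollification of $|g|^N$: by Jensen it dominates, it converges
    -- almost everywhere, and its integral does not depend on `n`.
    refine tendsto_integral_of_dominated_tendsto
      (G := fun n x => b x + C * 2 * 2 ^ N * mollify (fun x => ‖g x‖ ^ N) n x)
      (g := fun x => b x + C * 2 * 2 ^ N * ‖g x‖ ^ N)
      (fun n => aestronglyMeasurable_remainder (measurable_gradient _).aestronglyMeasurable)
      (fun n => hbi.add ((integrable_mollify hgi n).const_mul _)) (hbi.add (hgi.const_mul _))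
      (fun n => Eventually.of_forall fun x => ?_) ?_ ?_ ?_
    · have hm := norm_mollify_pow_le hg hN hgi.locallyIntegrable n x
      have hm0 : 0 ≤ mollify (fun x => ‖g x‖ ^ N) n x := le_trans (by positivity) hm
      rw [hzg]
      rcases lt_or_ge S ‖x‖ with hx | hx
      · rw [truncGradient, hη0 x hx, hηg0 x hx, zero_mul, zero_smul, smul_zero, add_zero,
          remainder_zero_right, abs_zero, hb, Set.indicator_of_notMem (by simpa using hx), zero_add]
        positivity
      · rw [hb, Set.indicator_of_mem (by simpa using hx)]
        set Y := truncGradient K η (mollify u n) (mollify g n) x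
        have h1 : ‖Y‖ ≤ ‖mollify g n x‖ + K * D :=
          (norm_truncGradient_le hK hη1 x).trans (by have := hD x; gcongr)
        have h2 : ‖Y‖ ^ N ≤ 2 ^ N * (mollify (fun x => ‖g x‖ ^ N) n x + (K * D) ^ N) :=
          (pow_le_pow_left₀ (norm_nonneg _) h1 _).trans
            ((add_pow_le_two_pow (norm_nonneg _) (by positivity) _).trans (by gcongr))
        have h3 : ‖∇ (vN N) x‖ ^ (N - 2) * ‖Y‖ ^ 2 ≤ A ^ N + ‖Y‖ ^ N := by
          have h4 : ‖∇ (vN N) x‖ ≤ A := norm_gradient_vN_le hN x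
          have e : N - 2 + 2 = N := by omega
          rcases le_total A ‖Y‖ with h5 | h5
          · calc _ ≤ ‖Y‖ ^ (N - 2) * ‖Y‖ ^ 2 := by
                  gcongr; exact h4.trans h5
              _ = ‖Y‖ ^ N := by rw [← pow_add, e]
              _ ≤ _ := by linarith [pow_nonneg hA0 N]
          · calc _ ≤ A ^ (N - 2) * A ^ 2 := by gcongr
              _ = A ^ N := by rw [← pow_add, e]
              _ ≤ _ := by linarith [pow_nonneg (norm_nonneg Y) N]
        calc _ ≤ C * (‖∇ (vN N) x‖ ^ (N - 2) * ‖Y‖ ^ 2 + ‖Y‖ ^ N) := hC _ _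
          _ ≤ C * ((A ^ N + ‖Y‖ ^ N) + ‖Y‖ ^ N) := by gcongr
          _ = C * (A ^ N + 2 * ‖Y‖ ^ N) := by ring
          _ ≤ C * (A ^ N + 2 * (2 ^ N * (mollify (fun x => ‖g x‖ ^ N) n x + (K * D) ^ N))) := by
              gcongr
          _ = _ := by ring
    · filter_upwards [hud, hgd] with x h1 h2
      simp only [hzg]
      refine tendsto_remainder ?_
      have h3 := (((continuous_softTruncDeriv K).tendsto _).comp h1).const_mul (η x)
      have h4 := (hsc.tendsto _).comp h1
      exact (h3.smul h2).add (h4.smul_const (∇ η x))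
    · filter_upwards [ae_tendsto_mollify hgi.locallyIntegrable] with x hx
      exact (hx.const_mul _).const_add _
    · refine tendsto_const_nhds.congr fun n => ?_
      rw [integral_add hbi (hgi.const_mul _),
        integral_add hbi ((integrable_mollify hgi n).const_mul _), integral_const_mul,
        integral_const_mul, integral_mollify hgi]
  have hzt : ∀ᵐ x ∂(muMeasure N), Tendsto (fun n => z n x) atTop
      (𝓝 (η x * softTrunc K (u x))) := by
    refine ae_muMeasure_of_ae ?_
    filter_upwards [hud] with x hx
    exact ((hsc.tendsto _).comp hx).const_mul _
  have hI : Tendsto (fun n => ∫ x, z n x ∂(muMeasure N)) atTop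
      (𝓝 (∫ x, η x * softTrunc K (u x) ∂(muMeasure N))) := by
    refine tendsto_integral_of_dominated_convergence (fun x => η x * K)
      (fun n => (hzd n).continuous.aestronglyMeasurable) ?_
      (fun n => Eventually.of_forall fun x => ?_) hzt
    · rw [integrable_muMeasure_iff hN]
      exact ((continuous_muDensity hN).mul (hη.continuous.mul
        continuous_const)).integrable_of_hasCompactSupport (hηc.mul_right.mul_left)
    · rw [norm_mul, Real.norm_of_nonneg (hη1 x).1]
      exact mul_le_mul_of_nonneg_left (abs_softTrunc_le hK _) (hη1 x).1
  refine lintegral_exp_le_of_tendsto (X := z) (fun n => (hzd n).continuous.measurable.aemeasurable)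
    hzt (((hR.const_mul (1 / omegaTilde N)).add hI).sub_const m) (Eventually.of_forall fun n => ?_)
  obtain ⟨L, hL⟩ := (hzd n).lipschitzWith_of_hasCompactSupport (hzc n) one_ne_zero
  exact h.lipschitz hN hL (hzc n)

theorem CarlesonChangBound.onofriBound (hN : 2 ≤ N) {m : ℝ}
    (h : CarlesonChangBound N (m - ∑ k ∈ Finset.Icc 1 (N - 1), (1 : ℝ) / k)) :
    OnofriBound N m := by
  rintro u ⟨hui, hex, hgN, hgv⟩
  have hug := hasWeakGradient_weakGradient hex
  set g := weakGradient Set.univ u with hgdef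
  have hum := (locallyIntegrableOn_univ.1 hug.1).aestronglyMeasurable
  have hgi : Integrable (fun x => ‖g x‖ ^ N) volume := hgN.integrable_norm_pow (by omega)
  have hk0 : ∀ k : ℕ, (0 : ℝ) < k + 1 := fun k => by positivity
  have hεpos : ∀ k : ℕ, (0 : ℝ) < (((k : ℝ) + 1) ^ N * (k + 1))⁻¹ := fun k => by positivity
  -- The truncation level at stage `k` is `k + 1`, so the cutoff error is multiplied by up to
  -- $(k+1)^N$. The prescribed energy leaves at most $1/(k+1)$.
  choose η hηd hηc hη1 hηR hηi hηE using fun k : ℕ => exists_cutoff hN (hεpos k) (k : ℝ)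
  set E : ℕ → EuclideanSpace ℝ (Fin N) → ℝ :=
    fun k x => ‖∇ (vN N) x‖ ^ (N - 2) * ‖∇ (η k) x‖ ^ 2 + ‖∇ (η k) x‖ ^ N with hE
  -- Every point eventually lies in the region where the cutoff is identically one, so its gradient
  -- there is eventually zero, not merely small.
  have hηev : ∀ x, ∀ᶠ k in atTop, η k =ᶠ[𝓝 x] fun _ => 1 := by
    intro x
    obtain ⟨n, hn⟩ := exists_nat_gt ‖x‖
    filter_upwards [eventually_ge_atTop n] with k hk
    have hk' : ‖x‖ < k := hn.trans_le (by exact_mod_cast hk)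
    filter_upwards [(isOpen_lt continuous_norm continuous_const).mem_nhds hk'] with y hy
    exact hηR k y hy
  have hη1t : ∀ x, Tendsto (fun k => η k x) atTop (𝓝 1) := fun x =>
    tendsto_const_nhds.congr' ((hηev x).mono fun k hk => hk.eq_of_nhds.symm)
  have hηg0 : ∀ x, ∀ᶠ k in atTop, ∇ (η k) x = 0 := fun x =>
    (hηev x).mono fun k hk => gradient_of_eventuallyEq_const hk
  obtain ⟨C, hC0, hC⟩ := abs_remainder_le hN
  set Y : ℕ → EuclideanSpace ℝ (Fin N) → EuclideanSpace ℝ (Fin N) :=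
    fun k => truncGradient (k + 1) (η k) u g with hY
  -- Integrability of `b` is exactly what membership in $W_{\mu_N}$ provides.
  set b : EuclideanSpace ℝ (Fin N) → ℝ :=
    fun x => C * 2 ^ N * (‖g x‖ ^ 2 * ‖∇ (vN N) x‖ ^ (N - 2) + ‖g x‖ ^ N) with hb
  have hbi : Integrable b volume := (hgv.add hgi).const_mul _
  have hR : Tendsto (fun k => ∫ x, remainder N (∇ (vN N) x) (Y k x)) atTop
      (𝓝 (∫ x, HN N u x)) := by
    refine tendsto_integral_of_dominated_tendsto
      (G := fun k x => b x + C * 2 ^ N * (((k : ℝ) + 1) ^ N * E k x)) (g := b)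
      (fun k => aestronglyMeasurable_remainder
        (aestronglyMeasurable_truncGradient _ (hηd k) hum hgN.1))
      (fun k => hbi.add (((hηi k).const_mul _).const_mul _)) hbi
      (fun k => Eventually.of_forall fun x => ?_) (Eventually.of_forall fun x => ?_)
      (Eventually.of_forall fun x => ?_) ?_
    · have h1 : ‖Y k x‖ ≤ ‖g x‖ + ((k : ℝ) + 1) * ‖∇ (η k) x‖ :=
        norm_truncGradient_le (hk0 k) (hη1 k) x
      have h2 : ∀ j, ‖Y k x‖ ^ j ≤ 2 ^ j * (‖g x‖ ^ j + ((k : ℝ) + 1) ^ j * ‖∇ (η k) x‖ ^ j) := by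
        intro j
        rw [← mul_pow]
        exact (pow_le_pow_left₀ (norm_nonneg _) h1 _).trans
          (add_pow_le_two_pow (norm_nonneg _) (by positivity) _)
      have h3 : (2 : ℝ) ^ 2 ≤ 2 ^ N := pow_le_pow_right₀ (by norm_num) hN
      have h4 : ((k : ℝ) + 1) ^ 2 ≤ ((k : ℝ) + 1) ^ N :=
        pow_le_pow_right₀ (by have := (k.cast_nonneg : (0 : ℝ) ≤ k); linarith) hN
      have h5 : ‖Y k x‖ ^ 2 ≤ 2 ^ N * (‖g x‖ ^ 2 + ((k : ℝ) + 1) ^ N * ‖∇ (η k) x‖ ^ 2) :=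
        (h2 2).trans (by gcongr)
      have h6 := h2 N
      calc _ ≤ C * (‖∇ (vN N) x‖ ^ (N - 2) * ‖Y k x‖ ^ 2 + ‖Y k x‖ ^ N) := hC _ _
        _ ≤ C * (‖∇ (vN N) x‖ ^ (N - 2)
              * (2 ^ N * (‖g x‖ ^ 2 + ((k : ℝ) + 1) ^ N * ‖∇ (η k) x‖ ^ 2))
            + 2 ^ N * (‖g x‖ ^ N + ((k : ℝ) + 1) ^ N * ‖∇ (η k) x‖ ^ N)) := by gcongr
        _ = _ := by simp only [hb, hE]; ring
    · rw [HN]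
      refine tendsto_remainder ?_
      have h1 : Tendsto (fun k => (η k x * softTruncDeriv ((k : ℝ) + 1) (u x)) • g x) atTop
          (𝓝 ((1 * 1 : ℝ) • g x)) :=
        ((hη1t x).mul (tendsto_softTruncDeriv (u x))).smul_const (g x)
      rw [mul_one, one_smul] at h1
      refine h1.congr' ?_
      filter_upwards [hηg0 x] with k hk
      rw [hY]
      simp only [truncGradient, hk, smul_zero, add_zero]
    · refine tendsto_const_nhds.congr' ?_
      filter_upwards [hηg0 x] with k hk
      simp [hE, hk, show N ≠ 0 by omega]
    · have e : ∀ k : ℕ, ∫ x, (b x + C * 2 ^ N * (((k : ℝ) + 1) ^ N * E k x))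
          = (∫ x, b x) + C * 2 ^ N * (((k : ℝ) + 1) ^ N * ∫ x, E k x) := by
        intro k
        rw [integral_add hbi (((hηi k).const_mul _).const_mul _),
          integral_const_mul (C * 2 ^ N) fun x => ((k : ℝ) + 1) ^ N * E k x,
          integral_const_mul (((k : ℝ) + 1) ^ N) (E k)]
      simp_rw [e]
      have h1 : Tendsto (fun k : ℕ => ((k : ℝ) + 1) ^ N * ∫ x, E k x) atTop (𝓝 0) := by
        refine squeeze_zero (fun k => ?_) (fun k => ?_) tendsto_one_div_add_atTop_nhds_zero_nat
        · have : 0 ≤ ∫ x, E k x := integral_nonneg fun x => by simp only [hE]; positivity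
          positivity
        · calc ((k : ℝ) + 1) ^ N * ∫ x, E k x
              ≤ ((k : ℝ) + 1) ^ N * (((k : ℝ) + 1) ^ N * (k + 1))⁻¹ := by
                have := hηE k
                gcongr
            _ = 1 / ((k : ℝ) + 1) := by have := hk0 k; field_simp
      simpa using (h1.const_mul (C * 2 ^ N)).const_add (∫ x, b x)
  have hzt : ∀ x, Tendsto (fun k => η k x * softTrunc ((k : ℝ) + 1) (u x)) atTop (𝓝 (u x)) := by
    intro x
    simpa using (hη1t x).mul (tendsto_softTrunc (u x))
  have hzm : ∀ k, AEStronglyMeasurable (fun x => η k x * softTrunc ((k : ℝ) + 1) (u x))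
      (muMeasure N) := fun k =>
    (hηd k).continuous.aestronglyMeasurable.mul
      ((contDiff_softTrunc _).continuous.comp_aestronglyMeasurable hui.1)
  have hI : Tendsto (fun k => ∫ x, η k x * softTrunc ((k : ℝ) + 1) (u x) ∂(muMeasure N)) atTop
      (𝓝 (∫ x, u x ∂(muMeasure N))) := by
    refine tendsto_integral_of_dominated_convergence (fun x => |u x|) hzm hui.abs
      (fun k => Eventually.of_forall fun x => ?_) (Eventually.of_forall hzt)
    rw [norm_mul, Real.norm_of_nonneg (hη1 k x).1]
    calc _ ≤ 1 * |u x| :=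
          mul_le_mul (hη1 k x).2 (abs_softTrunc_le_abs _ _) (abs_nonneg _) zero_le_one
      _ = _ := one_mul _
  exact lintegral_exp_le_of_tendsto (fun k => (hzm k).aemeasurable) (Eventually.of_forall hzt)
    (((hR.const_mul (1 / omegaTilde N)).add hI).sub_const m)
    (Eventually.of_forall fun k => h.truncation hN hug hgN (hηd k) (hηc k) (hη1 k) (hk0 k))

end

end Onofri

/-! ### Equality of the two infima -/

theorem theorem1p3 (N : ℕ) (hN : 2 ≤ N) :
    (⨅ u ∈ Onofri.weightedSobolev N, Onofri.functionalI N u) =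
      (⨅ u ∈ Onofri.sobolevW10 (N : ENNReal) (Onofri.unitBall N), Onofri.functionalJ N u) +
        ((∑ k ∈ Finset.Icc 1 (N - 1), (1 : ℝ) / k : ℝ) : EReal) := by
  refine Onofri.ereal_eq_of_forall_coe_le_iff fun m => ?_
  rw [Onofri.coe_le_add_coe_iff, Onofri.coe_le_iInf_functionalI_iff,
    Onofri.coe_le_iInf_functionalJ_iff]
  exact ⟨fun h => h.carlesonChangBound hN, fun h => h.onofriBound hN⟩
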